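/- Setting. Let $\Omega$ be a compact metric space with a non-atomic Borel probability measure $m$; $B(x,r)$ denotes a ball with centre $x$ and radius $r>0$. Let $\{R_\alpha\subset\Omega:\alpha\in J\}$ be a family of subsets indexed by an infinite countable set $J$, and let $\beta:J\to(0,\infty)$, $\alpha\mapsto\beta_\alpha$, be such that $\{\alpha\in J:\beta_\alpha\le M\}$ is finite for every $M$. For $A\subset\Omega$ put $\Delta(A,\eta)=\{x\in\Omega:\mathrm{dist}(x,A)<\eta\}$. Let $\psi:(0,\infty)\to(0,\infty)$ be decreasing (not necessarily strictly), and let $$\Lambda(\psi)=\{x\in\Omega: x\in\Delta(R_\alpha,\psi(\beta_\alpha))\text{ for infinitely many }\alpha\in J\}.$$ Let $\rho:(0,\infty)\to(0,\infty)$ satisfy $\rho(r)\to0$ as $r\to\infty$, and let $l=(l_n)$, $u=(u_n)$ be positive increasing sequences with $l_n<u_n$ for all $n$ and $l_n\to\infty$. Assume (M2): there are constants $\delta,a,b,r_0>0$ with $a\,r^\delta\le m(B(x,r))\le b\,r^\delta$ for all $x\in\Omega$ and $0<r\le r_0$. Assume that $(\{R_\alpha\},\beta)$ is a local $m$-ubiquitous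 system relative to $(\rho,l,u)$, with common dimension $\gamma$, that is: (a) there are $\kappa>0$ and $r_1>0$ such that for every ball $B=B(x,r)$ with $x\in\Omega$ and $0<r\le r_1$ there is $n_0(B)$ with $$m\Big(B\cap\bigcup_{\alpha\in J:\ l_n<\beta_\alpha\le u_n}\Delta(R_\alpha,\rho(u_n))\Big)\ge\kappa\,m(B)\qquad\text{for all }n\ge n_0(B);$$ (b) $0\le\gamma\le\dim\Omega$, and there are constants $c_1,c_2>0$ such that for all sufficiently large $n$, all $\alpha\in J$ with $\beta_\alpha\le u_n$, all $c\in R_\alpha$ and all $0<\lambda\le\rho(u_n)$, $$m\big(B(c,\tfrac12\rho(u_n))\cap\Delta(R_\alpha,\lambda)\big)\ge c_1\,m(B(c,\lambda))\Big(\frac{\rho(u_n)}{\lambda}\Big)^{\gamma},$$ $$m\big(B\cap B(c,3\rho(u_n))\cap\Delta(R_\alpha,3\lambda)\big)\le c_2\,m(B(c,\lambda))\Big(\frac{r(B)}{\lambda}\Big)^{\gamma}$$ for every ball $B$ of radius $r(B)\le3\rho(u_n)$ centred at a point of one of the sets $R_{\alpha'}$, $\alpha'\in J$. Write $\mathcal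 H^s$ for $s$-dimensional Hausdorff measure and $\dim$ for Hausdorff dimension. Conclusion. (i) If $\delta\ne\gamma$ and $\lim_{n\to\infty}\psi(u_n)/\rho(u_n)=0$, then $$\dim\Lambda(\psi)\ge d:=\gamma+\sigma(\delta-\gamma),\qquad\text{where }\ \sigma:=\limsup_{n\to\infty}\frac{\log\rho(u_n)}{\log\psi(u_n)}.$$ Moreover, if $\liminf_{n\to\infty}\rho(u_n)/\psi(u_n)^{\sigma}<\infty$, then $\mathcal H^{d}(\Lambda(\psi))=\infty$. (ii) If either $\delta=\gamma$ or $\limsup_{n\to\infty}\psi(u_n)/\rho(u_n)>0$, then $0<\mathcal H^{\delta}(\Lambda(\psi))<\infty$, and so $\dim\Lambda(\psi)=\delta$. -/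

import Mathlib

open Set Filter Topology MeasureTheory Metric

namespace Ubiquity

/-- An approximating function: a real, positive, decreasing (not necessarily strictly) function on
the positive reals. Values at non-positive arguments play no role. -/
structure IsApproximatingFunction (ψ : ℝ → ℝ) : Prop where
  pos : ∀ r, 0 < r → 0 < ψ r
  anti : AntitoneOn ψ (Ioi 0)

/-- The function in the definition of ubiquity: a positive function on the positive reals which
tends to zero at infinity. No monotonicity is assumed. -/
structure IsUbiquityFunction (ρ : ℝ → ℝ) : Prop where
  pos : ∀ r, 0 < r → 0 < ρ r
  tendsto_zero : Tendsto ρ atTop (𝓝 0)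

/-- A weight on the index set of the resonant sets: positive, and only finitely many indices
have weight below any given bound. -/
structure IsWeight {J : Type*} (β : J → ℝ) : Prop where
  pos : ∀ α, 0 < β α
  finite_le : ∀ M : ℝ, {α | β α ≤ M}.Finite

/-- `l` is a lower sequence and `u` an upper sequence: positive increasing sequences with
`l n < u n` for all `n` and `l n → ∞`. -/
structure IsLowerUpper (l u : ℕ → ℝ) : Prop where
  lower_pos : ∀ n, 0 < l n
  upper_pos : ∀ n, 0 < u n
  lower_mono : Monotone l
  upper_mono : Monotone u
  lt : ∀ n, l n < u n
  lower_tendsto : Tendsto l atTop atTop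

variable {Ω : Type*} [MetricSpace Ω] {J : Type*}

/-- The limsup set `Λ(ψ)`: the points lying in the open `ψ(β_α)`-neighbourhood of the resonant
set `R_α` for infinitely many indices `α`. -/
def limsupSet (R : J → Set Ω) (β : J → ℝ) (ψ : ℝ → ℝ) : Set Ω :=
  {x | {α | x ∈ thickening (ψ (β α)) (R α)}.Infinite}

/-- The index block `J_l^u(n)` of all `α` with `l_n < β_α ≤ u_n`. -/
def indexBlock (β : J → ℝ) (l u : ℕ → ℝ) (n : ℕ) : Set J :=
  {α | l n < β α ∧ β α ≤ u n}

/-- The set `Δ_l^u(ρ, n)`: the union over `α ∈ J_l^u(n)` of the `ρ(u_n)`-neighbourhoods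
of `R_α`. -/
def ubiquityUnion (R : J → Set Ω) (β : J → ℝ) (ρ : ℝ → ℝ) (l u : ℕ → ℝ) (n : ℕ) : Set Ω :=
  ⋃ α ∈ indexBlock β l u n, thickening (ρ (u n)) (R α)

variable [MeasurableSpace Ω]

/-- Condition (M2) with exponent `δ > 0`: the measure of every ball of small radius `r` is
comparable to `r ^ δ`, uniformly in the centre. -/
def ConditionM2 (m : Measure Ω) (δ : ℝ) : Prop :=
  0 < δ ∧ ∃ a b r₀ : ℝ, 0 < a ∧ 0 < b ∧ 0 < r₀ ∧
    ∀ (x : Ω) (r : ℝ), 0 < r → r ≤ r₀ →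
      a * r ^ δ ≤ m.real (ball x r) ∧ m.real (ball x r) ≤ b * r ^ δ

/-- The intersection conditions with common dimension `γ`, where `0 ≤ γ ≤ dim Ω`. The threshold
`n₀` and the constants `c₁`, `c₂` are uniform in `α`, in the centre `c`, in the thickness `t`
and in the ball `ball x r` (an arbitrary ball centred on some resonant set). -/
def IntersectionConditions (m : Measure Ω) (R : J → Set Ω) (β : J → ℝ) (ρ : ℝ → ℝ)
    (u : ℕ → ℝ) (γ : ℝ) : Prop :=
  0 ≤ γ ∧ ENNReal.ofReal γ ≤ dimH (univ : Set Ω) ∧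
    ∃ c₁ c₂ : ℝ, 0 < c₁ ∧ 0 < c₂ ∧ ∃ n₀ : ℕ, ∀ n, n₀ ≤ n →
      ∀ α, β α ≤ u n → ∀ c ∈ R α, ∀ t : ℝ, 0 < t → t ≤ ρ (u n) →
        c₁ * m.real (ball c t) * (ρ (u n) / t) ^ γ
            ≤ m.real (ball c (ρ (u n) / 2) ∩ thickening t (R α)) ∧
        ∀ α', ∀ x ∈ R α', ∀ r : ℝ, 0 < r → r ≤ 3 * ρ (u n) →
          m.real (ball x r ∩ ball c (3 * ρ (u n)) ∩ thickening (3 * t) (R α))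
            ≤ c₂ * m.real (ball c t) * (r / t) ^ γ

/-- `(R, β)` is a local `m`-ubiquitous system relative to `(ρ, l, u)`, with common dimension `γ`
of the resonant sets. The constant `κ` is absolute, while the threshold `n₀` may depend on the
ball. -/
def IsLocallyUbiquitous (m : Measure Ω) (R : J → Set Ω) (β : J → ℝ) (ρ : ℝ → ℝ)
    (l u : ℕ → ℝ) (γ : ℝ) : Prop :=
  (∃ κ r₀ : ℝ, 0 < κ ∧ 0 < r₀ ∧ ∀ (x : Ω) (r : ℝ), 0 < r → r ≤ r₀ →
    ∃ n₀ : ℕ, ∀ n, n₀ ≤ n →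
      κ * m.real (ball x r) ≤ m.real (ball x r ∩ ubiquityUnion R β ρ l u n)) ∧
  IntersectionConditions m R β ρ u γ

/-- The exponent `σ = limsup log ρ(u_n) / log ψ(u_n)`. It is used only when `ψ(u_n)/ρ(u_n) → 0`;
then `ψ(u_n) < ρ(u_n) < 1` for large `n`, the quotient is eventually in `(0, 1)`, and the
real-valued limsup is the genuine one. -/
noncomputable def logExponent (ρ ψ : ℝ → ℝ) (u : ℕ → ℝ) : ℝ :=
  limsup (fun n => Real.log (ρ (u n)) / Real.log (ψ (u n))) atTop

end Ubiquity

/-!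
Part (i) uses measures `ν` with `ν B ≤ ε r ^ s` on all balls of small radius `r`, carried by nested
compact sets whose intersection lies in `Λ(ψ)`. Here `ε > 0` is arbitrary while the masses stay
bounded below by some `c > 0`, so the mass distribution principle gives a lower bound for
`H^s(Λ(ψ))` of order `c / ε`. To construct the measures, ubiquity supplies at infinitely many scales
`p = ρ(u n)` a maximal `3p`-separated set of centres on resonant sets, so rich that a given measure
of bounded density can be relocated, by an arbitrarily small distance, into the pieces
`B(c, p / 2) ∩ Δ(R_α, ψ(u n) / 2)` around these centres; the intersection conditions bound the
growth of the relocated measure by a multiple of `r ^ s`. Relocations to many widely different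
scales have their growth concentrated in disjoint ranges of radii, so the average of `N` of them has
growth constant `O(1 / N)`. This averaging is iterated inside the open sets obtained so far.

For part (ii), the same pieces show that the `n`-th block of neighbourhoods has measure bounded
below for infinitely many `n`, so that `m(Λ(ψ)) > 0`, and `m` is comparable to `H^δ`.
-/

open scoped ENNReal NNReal ProbabilityTheory

namespace Ubiquity

section SeparatedNet

variable {Ω : Type*} [PseudoMetricSpace Ω]

theorem exists_separated_net (T : Set Ω) {η : ℝ} (hη : 0 ≤ η) :
    ∃ Z ⊆ T, Z.Pairwise (fun x y => η < dist x y) ∧ ∀ y ∈ T, ∃ x ∈ Z, dist y x ≤ η := by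
  obtain ⟨Z, hZ⟩ := zorn_subset {Z : Set Ω | Z ⊆ T ∧ Z.Pairwise fun x y => η < dist x y}
    fun 𝒞 h𝒞 hchain => ⟨⋃₀ 𝒞, ⟨sUnion_subset fun Z hZ => (h𝒞 hZ).1,
      (pairwise_sUnion hchain.directedOn).2 fun Z hZ => (h𝒞 hZ).2⟩,
      fun Z hZ => subset_sUnion_of_mem hZ⟩
  refine ⟨Z, hZ.prop.1, hZ.prop.2, fun y hy => ?_⟩
  by_contra! hfar
  have hins : insert y Z ⊆ Z := hZ.le_of_ge ⟨insert_subset hy hZ.prop.1,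
    hZ.prop.2.insert fun z hz _ => ⟨hfar z hz, dist_comm y z ▸ hfar z hz⟩⟩ (subset_insert y Z)
  have := hfar y (hins (mem_insert y Z))
  rw [dist_self] at this
  exact hη.not_gt this

end SeparatedNet

section AhlforsRegular

variable {Ω : Type*} [MetricSpace Ω] [MeasurableSpace Ω]

/-- `m` is Ahlfors regular of exponent `δ`: the normalised form of condition (M2), with the lower
bound for radii up to `1` and the upper bound for all radii. -/
structure IsAhlforsRegular (m : Measure Ω) (δ a b : ℝ) : Prop where
  exp_pos : 0 < δ
  lower_pos : 0 < a
  upper_pos : 0 < b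
  lower : ∀ x r, 0 < r → r ≤ 1 → a * r ^ δ ≤ m.real (ball x r)
  upper : ∀ x r, 0 < r → m.real (ball x r) ≤ b * r ^ δ

theorem ConditionM2.exists_isAhlforsRegular {m : Measure Ω} [IsFiniteMeasure m] {δ : ℝ}
    (h : ConditionM2 m δ) : ∃ a b, IsAhlforsRegular m δ a b := by
  obtain ⟨hδ, a, b, r₀, ha, hb, hr₀, H⟩ := h
  have hr1 : 0 < min r₀ 1 := lt_min hr₀ one_pos
  refine ⟨a * (min r₀ 1) ^ δ, max b (m.real univ * (r₀ ^ δ)⁻¹), hδ, by positivity,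
    lt_max_of_lt_left hb, fun x r hr hr1' => ?_, fun x r hr => ?_⟩
  · have hsmall : min r₀ 1 * r ≤ r := mul_le_of_le_one_left hr.le (min_le_right _ _)
    have hle : min r₀ 1 * r ≤ r₀ :=
      (mul_le_of_le_one_right hr1.le hr1').trans (min_le_left _ _)
    calc a * min r₀ 1 ^ δ * r ^ δ = a * (min r₀ 1 * r) ^ δ := by
          rw [Real.mul_rpow hr1.le hr.le, mul_assoc]
      _ ≤ m.real (ball x (min r₀ 1 * r)) := (H x _ (by positivity) hle).1
      _ ≤ m.real (ball x r) := measureReal_mono (ball_subset_ball hsmall)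
  · rcases le_total r r₀ with h | h
    · refine (H x r hr h).2.trans ?_
      gcongr
      exact le_max_left _ _
    · calc m.real (ball x r) ≤ m.real univ := measureReal_mono (subset_univ _)
        _ = m.real univ * (r₀ ^ δ)⁻¹ * r₀ ^ δ := by field_simp
        _ ≤ max b (m.real univ * (r₀ ^ δ)⁻¹) * r ^ δ := by
          gcongr
          exact le_max_right _ _

theorem IsAhlforsRegular.neZero [Nonempty Ω] {m : Measure Ω} {δ a b : ℝ}
    (hm : IsAhlforsRegular m δ a b) : NeZero m := by
  refine ⟨fun h => ?_⟩
  have hball := hm.lower (Classical.arbitrary Ω) 1 one_pos le_rfl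
  rw [h, measureReal_zero_apply, Real.one_rpow, mul_one] at hball
  exact hball.not_gt hm.lower_pos

namespace IsAhlforsRegular

variable {m : Measure Ω} [IsFiniteMeasure m] {δ a b : ℝ}

section BorelSpace

variable [BorelSpace Ω]

theorem card_mul_le_measureReal (hm : IsAhlforsRegular m δ a b) {Z : Finset Ω} {A : Set Ω} {η : ℝ}
    (hη : 0 < η) (hη2 : η ≤ 2) (hsep : (Z : Set Ω).Pairwise fun x y => η ≤ dist x y)
    (hA : ∀ c ∈ Z, ball c (η / 2) ⊆ A) : Z.card * (a * (η / 2) ^ δ) ≤ m.real A := by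
  have hdisj : (Z : Set Ω).PairwiseDisjoint fun c => ball c (η / 2) := fun c hc c' hc' hne =>
    ball_disjoint_ball (by linarith [hsep hc hc' hne])
  calc Z.card * (a * (η / 2) ^ δ) = ∑ c ∈ Z, a * (η / 2) ^ δ := by
        rw [Finset.sum_const, nsmul_eq_mul]
    _ ≤ ∑ c ∈ Z, m.real (ball c (η / 2)) :=
      Finset.sum_le_sum fun c _ => hm.lower _ _ (by positivity) (by linarith)
    _ = m.real (⋃ c ∈ Z, ball c (η / 2)) :=
      (measureReal_biUnion_finset hdisj fun _ _ => measurableSet_ball).symm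
    _ ≤ m.real A := measureReal_mono (iUnion₂_subset hA)

theorem finite_of_pairwise_lt_dist (hm : IsAhlforsRegular m δ a b) {Z : Set Ω} {η : ℝ}
    (hη : 0 < η) (hZ : Z.Pairwise fun x y => η < dist x y) : Z.Finite := by
  have ha := hm.lower_pos
  set η' := min η 2
  have hη' : 0 < η' := lt_min hη zero_lt_two
  obtain ⟨N, hN⟩ := exists_nat_gt (m.real univ / (a * (η' / 2) ^ δ))
  rw [div_lt_iff₀ (by positivity)] at hN
  by_contra hinf
  obtain ⟨S, hSZ, rfl⟩ := Set.Infinite.exists_subset_card_eq hinf N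
  exact hN.not_ge (hm.card_mul_le_measureReal hη' (min_le_right _ _)
    (fun x hx y hy hxy => (min_le_left _ _).trans (hZ (hSZ hx) (hSZ hy) hxy).le)
    fun _ _ => subset_univ _)

theorem exists_finset_separated_net (hm : IsAhlforsRegular m δ a b) (T : Set Ω) {η : ℝ}
    (hη : 0 < η) : ∃ Z : Finset Ω, (Z : Set Ω) ⊆ T ∧
      (Z : Set Ω).Pairwise (fun x y => η < dist x y) ∧ ∀ y ∈ T, ∃ x ∈ Z, dist y x ≤ η := by
  obtain ⟨Z, hZT, hsep, hcov⟩ := exists_separated_net T hη.le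
  lift Z to Finset Ω using hm.finite_of_pairwise_lt_dist hη hsep
  exact ⟨Z, hZT, hsep, hcov⟩

theorem compactSpace [CompleteSpace Ω] (hm : IsAhlforsRegular m δ a b) : CompactSpace Ω := by
  suffices hT : TotallyBounded (univ : Set Ω) from
    isCompact_univ_iff.1 (hT.isCompact_of_isClosed isClosed_univ)
  refine Metric.totallyBounded_iff.2 fun ε hε => ?_
  obtain ⟨Z, -, -, hcov⟩ := hm.exists_finset_separated_net univ (half_pos hε)
  refine ⟨Z, Z.finite_toSet, fun y hy => ?_⟩
  obtain ⟨x, hx, hyx⟩ := hcov y hy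
  exact mem_biUnion (Finset.mem_coe.2 hx) (hyx.trans_lt (half_lt_self hε))

theorem exists_finset_cover_sum_ediam_rpow_le (hm : IsAhlforsRegular m δ a b) {η : ℝ}
    (hη : 0 < η) (hη2 : η ≤ 2) : ∃ Z : Finset Ω, (∀ y, ∃ x ∈ Z, y ∈ closedBall x η) ∧
      ∑ x ∈ Z, ediam (closedBall x η) ^ δ ≤ ENNReal.ofReal (4 ^ δ / a * m.real univ) := by
  have hδ := hm.exp_pos
  have ha := hm.lower_pos
  obtain ⟨Z, -, hsep, hcov⟩ := hm.exists_finset_separated_net univ hη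
  refine ⟨Z, fun y => hcov y (mem_univ y), ?_⟩
  have hcard := hm.card_mul_le_measureReal hη hη2 (hsep.mono' fun _ _ h => h.le)
    fun _ _ => subset_univ _
  have hdiam : ∀ x : Ω, ediam (closedBall x η) ^ δ ≤ ENNReal.ofReal ((2 * η) ^ δ) := fun x => by
    rw [← ENNReal.ofReal_rpow_of_pos (by positivity), ENNReal.ofReal_mul zero_le_two,
      ENNReal.ofReal_ofNat 2, ← closedEBall_ofReal hη.le]
    gcongr
    exact ediam_closedEBall_le
  have hscale : (2 * η) ^ δ = 4 ^ δ * (η / 2) ^ δ := by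
    rw [← Real.mul_rpow (by norm_num) (by positivity)]
    ring_nf
  calc ∑ x ∈ Z, ediam (closedBall x η) ^ δ ≤ ∑ _x ∈ Z, ENNReal.ofReal ((2 * η) ^ δ) :=
        Finset.sum_le_sum fun x _ => hdiam x
    _ = ENNReal.ofReal (4 ^ δ / a * (Z.card * (a * (η / 2) ^ δ))) := by
        rw [Finset.sum_const, nsmul_eq_mul, ← ENNReal.ofReal_natCast,
          ← ENNReal.ofReal_mul (by positivity), hscale]
        field_simp
    _ ≤ _ := by gcongr

theorem hausdorffMeasure_univ_lt_top (hm : IsAhlforsRegular m δ a b) :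
    Measure.hausdorffMeasure δ (univ : Set Ω) < ⊤ := by
  set η : ℕ → ℝ := fun n => 1 / ((n : ℝ) + 1)
  have hη : ∀ n, 0 < η n := fun n => by positivity
  have hη1 : ∀ n, η n ≤ 2 := fun n =>
    ((div_le_one (by positivity)).2 (by linarith [n.cast_nonneg (α := ℝ)])).trans one_le_two
  choose Z hZcov hZsum using fun n => hm.exists_finset_cover_sum_ediam_rpow_le (hη n) (hη1 n)
  have hlim : Tendsto (fun n => 2 * ENNReal.ofReal (η n)) atTop (𝓝 0) := by
    have := ENNReal.tendsto_ofReal (tendsto_one_div_add_atTop_nhds_zero_nat (𝕜 := ℝ))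
    simpa only [ENNReal.ofReal_zero, mul_zero] using
      ENNReal.Tendsto.const_mul this (Or.inr (ENNReal.ofNat_ne_top (n := 2)))
  refine (Measure.hausdorffMeasure_le_liminf_sum δ (univ : Set Ω) _ hlim
    (fun n (i : Z n) => closedBall (i : Ω) (η n)) (Eventually.of_forall fun n i => ?_)
    (Eventually.of_forall fun n y _ => ?_)).trans_lt ?_
  · rw [← closedEBall_ofReal (hη n).le]
    exact ediam_closedEBall_le
  · obtain ⟨x, hx, hyx⟩ := hZcov n y
    exact mem_iUnion.2 ⟨⟨x, hx⟩, hyx⟩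
  · refine (liminf_le_of_frequently_le' (Frequently.of_forall fun n => ?_)).trans_lt
      (ENNReal.ofReal_lt_top (r := 4 ^ δ / a * m.real univ))
    rw [Finset.sum_coe_sort (Z n) fun x => ediam (closedBall x (η n)) ^ δ]
    exact hZsum n

theorem dimH_univ_le (hm : IsAhlforsRegular m δ a b) :
    dimH (univ : Set Ω) ≤ ENNReal.ofReal δ := by
  have h := hm.hausdorffMeasure_univ_lt_top.ne
  have hδ := hm.exp_pos
  lift δ to ℝ≥0 using hδ.le
  rw [ENNReal.ofReal_coe_nnreal]
  exact dimH_le_of_hausdorffMeasure_ne_top h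

end BorelSpace

end IsAhlforsRegular

end AhlforsRegular

section MassDistributionPrinciple

variable {Ω : Type*} [MetricSpace Ω] [MeasurableSpace Ω] {s C r₀ : ℝ}

theorem exists_isOpen_superset_measure_le (hs : 0 ≤ s) (hC : 0 ≤ C) {T : Set Ω}
    (hT : ediam T < ENNReal.ofReal r₀) {e : ℝ≥0} (he : 0 < e) :
    ∃ O, IsOpen O ∧ T ⊆ O ∧ ∀ μ : Measure Ω, IsFiniteMeasure μ →
      (∀ y r, 0 < r → r ≤ r₀ → μ.real (ball y r) ≤ C * r ^ s) →
      μ O ≤ ENNReal.ofReal C * (⨆ _ : T.Nonempty, ediam T ^ s) + e := by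
  rcases T.eq_empty_or_nonempty with rfl | hne
  · exact ⟨∅, isOpen_empty, subset_rfl, by simp⟩
  obtain ⟨y, hy⟩ := hne
  have hfin : ediam T ≠ ⊤ := hT.ne_top
  have hbdd : Bornology.IsBounded T := isBounded_iff_ediam_ne_top.2 hfin
  have hdiam : diam T < r₀ := (ENNReal.lt_ofReal_iff_toReal_lt hfin).1 hT
  have hcont : Tendsto (fun x : ℝ => C * x ^ s) (𝓝[>] diam T) (𝓝 (C * diam T ^ s)) :=
    ((Real.continuousAt_rpow_const _ s (Or.inr hs)).tendsto.mono_left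
      nhdsWithin_le_nhds).const_mul C
  have hlt : C * diam T ^ s < C * diam T ^ s + e := lt_add_of_pos_right _ (NNReal.coe_pos.2 he)
  obtain ⟨r, hrC, hr, hrr₀⟩ :=
    ((hcont.eventually_lt_const hlt).and (Ioo_mem_nhdsGT hdiam)).exists
  refine ⟨ball y r, isOpen_ball, fun x hx => (dist_le_diam_of_mem hbdd hx hy).trans_lt hr,
    fun μ _ hμ => ?_⟩
  calc μ (ball y r) = ENNReal.ofReal (μ.real (ball y r)) := by rw [ofReal_measureReal]
    _ ≤ ENNReal.ofReal (C * diam T ^ s + e) :=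
      ENNReal.ofReal_le_ofReal ((hμ y r (diam_nonneg.trans_lt hr) hrr₀.le).trans hrC.le)
    _ = ENNReal.ofReal C * (⨆ _ : T.Nonempty, ediam T ^ s) + e := by
      rw [ENNReal.ofReal_add (mul_nonneg hC (Real.rpow_nonneg diam_nonneg s)) e.coe_nonneg,
        ENNReal.ofReal_mul hC, ← ENNReal.ofReal_rpow_of_nonneg diam_nonneg hs, diam,
        ENNReal.ofReal_toReal hfin, iSup_pos ⟨y, hy⟩, ENNReal.ofReal_coe_nnreal]

theorem measure_le_mul_ediam_rpow {μ : Measure Ω} [IsFiniteMeasure μ] (hs : 0 ≤ s) (hC : 0 ≤ C)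
    (hμ : ∀ y r, 0 < r → r ≤ r₀ → μ.real (ball y r) ≤ C * r ^ s) {T : Set Ω}
    (hT : ediam T < ENNReal.ofReal r₀) : μ T ≤ ENNReal.ofReal C * ediam T ^ s := by
  refine ENNReal.le_of_forall_pos_le_add fun e he _ => ?_
  obtain ⟨O, -, hTO, hO⟩ := exists_isOpen_superset_measure_le hs hC hT he
  refine (measure_mono hTO).trans ((hO μ ‹_› hμ).trans ?_)
  gcongr
  exact iSup_le fun _ => le_rfl

variable [BorelSpace Ω]

theorem measure_le_mul_hausdorffMeasure {μ : Measure Ω} [IsFiniteMeasure μ] (hs : 0 ≤ s)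
    (hC : 0 < C) (hr₀ : 0 < r₀) (hμ : ∀ y r, 0 < r → r ≤ r₀ → μ.real (ball y r) ≤ C * r ^ s)
    (A : Set Ω) : μ A ≤ ENNReal.ofReal C * Measure.hausdorffMeasure s A := by
  have hC0 : ENNReal.ofReal C ≠ 0 := (ENNReal.ofReal_pos.2 hC).ne'
  have hle : (ENNReal.ofReal C)⁻¹ • μ ≤ Measure.hausdorffMeasure s := by
    refine Measure.le_hausdorffMeasure s _ (ENNReal.ofReal (r₀ / 2)) (by positivity) fun T hT => ?_
    rw [Measure.smul_apply, smul_eq_mul, ENNReal.inv_mul_le_iff hC0 ENNReal.ofReal_ne_top]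
    exact measure_le_mul_ediam_rpow hs hC.le hμ
      (hT.trans_lt ((ENNReal.ofReal_lt_ofReal_iff hr₀).2 (half_lt_self hr₀)))
  simpa [ENNReal.inv_mul_le_iff hC0 ENNReal.ofReal_ne_top] using hle A

/- An open cover of `⋂ k, K k` already covers some `K k` by compactness, so no limit measure is
needed. -/
theorem le_mul_hausdorffMeasure_iInter {K : ℕ → Set Ω} (hKanti : Antitone K)
    (hK : ∀ k, IsCompact (K k)) {μ : ℕ → Measure Ω} [∀ k, IsFiniteMeasure (μ k)] (hs : 0 ≤ s)
    (hC : 0 < C) (hr₀ : 0 < r₀) {c : ℝ≥0∞} (hc : ∀ k, c ≤ μ k (K k))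
    (hμ : ∀ k y r, 0 < r → r ≤ r₀ → (μ k).real (ball y r) ≤ C * r ^ s) :
    c ≤ ENNReal.ofReal C * Measure.hausdorffMeasure s (⋂ k, K k) := by
  have hC0 : ENNReal.ofReal C ≠ 0 := (ENNReal.ofReal_pos.2 hC).ne'
  rw [mul_comm, ← ENNReal.div_le_iff_le_mul (Or.inl hC0) (Or.inl ENNReal.ofReal_ne_top),
    Measure.hausdorffMeasure_apply]
  refine le_iSup₂_of_le (ENNReal.ofReal (r₀ / 2)) (by positivity)
    (le_iInf fun t => le_iInf₂ fun hcover hdiam => ?_)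
  rw [ENNReal.div_le_iff_le_mul (Or.inl hC0) (Or.inl ENNReal.ofReal_ne_top), mul_comm]
  refine ENNReal.le_of_forall_pos_le_add fun ε hε _ => ?_
  obtain ⟨e, he, hesum⟩ := ENNReal.exists_pos_sum_of_countable (ENNReal.coe_pos.2 hε).ne' ℕ
  choose O hO htO hOμ using fun n => exists_isOpen_superset_measure_le hs hC.le
    ((hdiam n).trans_lt ((ENNReal.ofReal_lt_ofReal_iff hr₀).2 (half_lt_self hr₀))) (he n)
  obtain ⟨k, hk⟩ := exists_subset_nhds_of_isCompact hKanti.directed_ge hK fun x hx =>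
    (isOpen_iUnion hO).mem_nhds (iUnion_mono htO (hcover hx))
  calc c ≤ μ k (⋃ n, O n) := (hc k).trans (measure_mono hk)
    _ ≤ ∑' n, μ k (O n) := measure_iUnion_le _
    _ ≤ ∑' n, (ENNReal.ofReal C * (⨆ _ : (t n).Nonempty, ediam (t n) ^ s) + e n) :=
      ENNReal.tsum_le_tsum fun n => hOμ n _ inferInstance (hμ k)
    _ ≤ _ := by
      rw [ENNReal.tsum_add, ENNReal.tsum_mul_left]
      gcongr

theorem IsAhlforsRegular.hausdorffMeasure_pos {m : Measure Ω} [IsFiniteMeasure m] {δ a b : ℝ}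
    (hm : IsAhlforsRegular m δ a b) {A : Set Ω} (hA : 0 < m A) :
    0 < Measure.hausdorffMeasure δ A :=
  pos_of_mul_pos_right (hA.trans_le (measure_le_mul_hausdorffMeasure hm.exp_pos.le hm.upper_pos
    one_pos (fun y r hr _ => hm.upper y r hr) A)) zero_le

theorem IsAhlforsRegular.dimH_eq_of_measure_pos {m : Measure Ω} [IsFiniteMeasure m] {δ a b : ℝ}
    (hm : IsAhlforsRegular m δ a b) {A : Set Ω} (hA : 0 < m A) : dimH A = ENNReal.ofReal δ := by
  refine ((dimH_mono (subset_univ A)).trans hm.dimH_univ_le).antisymm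
    (le_dimH_of_hausdorffMeasure_ne_zero ?_)
  rw [Real.coe_toNNReal _ hm.exp_pos.le]
  exact (hm.hausdorffMeasure_pos hA).ne'

end MassDistributionPrinciple

theorem exists_rpow_le_rpow {s t : ℝ} (hst : s < t) (K : ℝ) {e : ℝ} (he : 0 < e) :
    ∃ r₀ > 0, ∀ r, 0 < r → r < r₀ → K * r ^ t ≤ e * r ^ s := by
  have hlim : Tendsto (fun r : ℝ => K * r ^ (t - s)) (𝓝[>] 0) (𝓝 0) := by
    have := (Real.continuousAt_rpow_const 0 (t - s) (Or.inr (sub_pos.2 hst).le)).tendsto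
    rw [Real.zero_rpow (sub_pos.2 hst).ne'] at this
    simpa only [mul_zero] using (this.mono_left nhdsWithin_le_nhds).const_mul K
  obtain ⟨r₀, hr₀, H⟩ := mem_nhdsGT_iff_exists_Ioo_subset.1 (hlim.eventually (gt_mem_nhds he))
  refine ⟨r₀, hr₀, fun r hr hrr₀ => ?_⟩
  calc K * r ^ t = K * r ^ (t - s) * r ^ s := by
        rw [mul_assoc, ← Real.rpow_add hr, sub_add_cancel]
    _ ≤ e * r ^ s := by
        gcongr
        exact (H ⟨hr, hrr₀⟩ : K * r ^ (t - s) < e).le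

section BoundedDensity

variable {Ω : Type*} [MetricSpace Ω] [MeasurableSpace Ω] {m μ ν : Measure Ω} {U V : Set Ω}

/-- `μ` is carried by the open set `U` and has a bounded density with respect to `m`: the measures
between which mass is moved in the construction. -/
structure HasBoundedDensityOn (μ m : Measure Ω) (U : Set Ω) : Prop where
  isOpen : IsOpen U
  measure_compl : μ Uᶜ = 0
  exists_le_smul : ∃ D : ℝ≥0, μ ≤ D • m

namespace HasBoundedDensityOn

theorem zero : HasBoundedDensityOn 0 m (∅ : Set Ω) :=
  ⟨isOpen_empty, rfl, 0, (zero_smul ℝ≥0 m).ge⟩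

theorem add (hμ : HasBoundedDensityOn μ m U) (hν : HasBoundedDensityOn ν m V) :
    HasBoundedDensityOn (μ + ν) m (U ∪ V) := by
  obtain ⟨D, hD⟩ := hμ.exists_le_smul
  obtain ⟨D', hD'⟩ := hν.exists_le_smul
  refine ⟨hμ.isOpen.union hν.isOpen, ?_, D + D', add_smul D D' m ▸ add_le_add hD hD'⟩
  rw [Measure.add_apply, measure_mono_null (compl_subset_compl.2 subset_union_left)
    hμ.measure_compl, measure_mono_null (compl_subset_compl.2 subset_union_right)
    hν.measure_compl, add_zero]

theorem smul (hμ : HasBoundedDensityOn μ m U) (c : ℝ≥0) : HasBoundedDensityOn (c • μ) m U := by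
  obtain ⟨D, hD⟩ := hμ.exists_le_smul
  refine ⟨hμ.isOpen, ?_, c * D, mul_smul c D m ▸ smul_le_smul_left c hD⟩
  rw [Measure.smul_apply, hμ.measure_compl, smul_zero]

theorem sum {ι : Type*} {S : Finset ι} {μ : ι → Measure Ω} {U : ι → Set Ω}
    (h : ∀ i ∈ S, HasBoundedDensityOn (μ i) m (U i)) :
    HasBoundedDensityOn (∑ i ∈ S, μ i) m (⋃ i ∈ S, U i) := by
  classical
  induction S using Finset.induction_on with
  | empty => simpa using zero
  | insert i S hi ih =>
    rw [Finset.sum_insert hi, Finset.set_biUnion_insert]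
    exact (h i (Finset.mem_insert_self i S)).add
      (ih fun j hj => h j (Finset.mem_insert_of_mem hj))

variable [IsFiniteMeasure m]

theorem isFiniteMeasure (hμ : HasBoundedDensityOn μ m U) : IsFiniteMeasure μ := by
  obtain ⟨D, hD⟩ := hμ.exists_le_smul
  exact isFiniteMeasure_of_le _ hD

theorem exists_real_ball_le (hμ : HasBoundedDensityOn μ m U) {δ a b : ℝ}
    (hm : IsAhlforsRegular m δ a b) : ∃ G > 0, ∀ y r, 0 < r → μ.real (ball y r) ≤ G * r ^ δ := by
  obtain ⟨D, hD⟩ := hμ.exists_le_smul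
  have hb := hm.upper_pos
  refine ⟨(D + 1) * b, by positivity, fun y r hr => ?_⟩
  calc μ.real (ball y r) ≤ (D • m).real (ball y r) :=
        ENNReal.toReal_mono (measure_ne_top _ _) (hD _)
    _ = D * m.real (ball y r) := measureReal_nnreal_smul_apply ..
    _ ≤ (D + 1) * (b * r ^ δ) := by
      gcongr
      · exact le_add_of_nonneg_right zero_le_one
      · exact hm.upper y r hr
    _ = (D + 1) * b * r ^ δ := (mul_assoc ..).symm

theorem exists_real_ball_le_rpow (hμ : HasBoundedDensityOn μ m U) {δ a b s e : ℝ}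
    (hm : IsAhlforsRegular m δ a b) (hs : s < δ) (he : 0 < e) :
    ∃ t > 0, ∀ y r, 0 < r → r < t → μ.real (ball y r) ≤ e * r ^ s := by
  obtain ⟨G, -, hG⟩ := hμ.exists_real_ball_le hm
  obtain ⟨t, ht, h⟩ := exists_rpow_le_rpow hs G he
  exact ⟨t, ht, fun y r hr hrt => (hG y r hr).trans (h r hr hrt)⟩

end HasBoundedDensityOn

theorem hasBoundedDensityOn_cond [BorelSpace Ω] {F : Set Ω} (hF : IsOpen F) (hm : 0 < m.real F) :
    HasBoundedDensityOn (m[|F]) m F := by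
  have hF0 : m F ≠ 0 := (ENNReal.toReal_pos_iff.1 hm).1.ne'
  refine ⟨hF, ProbabilityTheory.cond_apply hF.measurableSet m Fᶜ ▸ by simp,
    ((m F)⁻¹).toNNReal, ?_⟩
  calc m[|F] = (m F)⁻¹ • m.restrict F := rfl
    _ ≤ (m F)⁻¹ • m := by gcongr; exact Measure.restrict_le_self
    _ = ((m F)⁻¹).toNNReal • m := by
      rw [← ENNReal.coe_toNNReal (ENNReal.inv_ne_top.2 hF0)]
      rfl

end BoundedDensity

section Spreading

variable {Ω : Type*} [MetricSpace Ω] [MeasurableSpace Ω] {m : Measure Ω} {E : Set Ω}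
  {δ s C p : ℝ} {Z Z' : Finset Ω} {F : Ω → Set Ω}

/-- A family of well separated open pieces `F c`, `c ∈ Z`, of the set `E`, of size at most `p`, such
that the uniform distribution on each piece satisfies a growth condition of exponent `s`. -/
structure IsPieceFamily (m : Measure Ω) (E : Set Ω) (δ s C p : ℝ) (Z : Finset Ω)
    (F : Ω → Set Ω) : Prop where
  scale_pos : 0 < p
  pairwise : (Z : Set Ω).Pairwise fun c c' => 3 * p ≤ dist c c'
  isOpen : ∀ c ∈ Z, IsOpen (F c)
  subset_ball : ∀ c ∈ Z, F c ⊆ ball c (p / 2)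
  closure_subset : ∀ c ∈ Z, closure (F c) ⊆ E
  measure_pos : ∀ c ∈ Z, 0 < m.real (F c)
  growth : ∀ c ∈ Z, ∀ y r, 0 < r → r ≤ p → (m[|F c]).real (ball y r) * p ^ δ ≤ C * r ^ s

/-- The measure which spreads the mass `w c` uniformly, with respect to `m`, over `F c`. -/
noncomputable def spreadMeasure (m : Measure Ω) (Z : Finset Ω) (F : Ω → Set Ω) (w : Ω → ℝ≥0) :
    Measure Ω :=
  ∑ c ∈ Z, w c • m[|F c]

theorem spreadMeasure_real_apply {Ω : Type*} [MeasurableSpace Ω] {m : Measure Ω} {Z : Finset Ω}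
    {F : Ω → Set Ω} {w : Ω → ℝ≥0} (A : Set Ω) :
    (spreadMeasure m Z F w).real A = ∑ c ∈ Z, w c * (m[|F c]).real A := by
  rw [spreadMeasure, measureReal_def, Measure.finsetSum_apply, ENNReal.toReal_sum]
  · exact Finset.sum_congr rfl fun c _ => measureReal_nnreal_smul_apply ..
  · exact fun c _ => measure_ne_top _ _

namespace IsPieceFamily

theorem mono (h : IsPieceFamily m E δ s C p Z F) (hZ : Z' ⊆ Z) :
    IsPieceFamily m E δ s C p Z' F where
  scale_pos := h.scale_pos
  pairwise := h.pairwise.mono hZ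
  isOpen c hc := h.isOpen c (hZ hc)
  subset_ball c hc := h.subset_ball c (hZ hc)
  closure_subset c hc := h.closure_subset c (hZ hc)
  measure_pos c hc := h.measure_pos c (hZ hc)
  growth c hc := h.growth c (hZ hc)

variable {w : Ω → ℝ≥0} {L r : ℝ} {y : Ω}

theorem closure_biUnion_subset (h : IsPieceFamily m E δ s C p Z F) :
    closure (⋃ c ∈ Z, F c) ⊆ E := by
  rw [Z.closure_biUnion]
  exact iUnion₂_subset h.closure_subset

theorem subsingleton_meeting_ball (h : IsPieceFamily m E δ s C p Z F) (hr : r ≤ p / 2) :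
    {c | c ∈ Z ∧ (F c ∩ ball y r).Nonempty}.Subsingleton := by
  rintro c ⟨hc, z, hzc, hzy⟩ c' ⟨hc', z', hzc', hzy'⟩
  by_contra hne
  have hcz := mem_ball'.1 (h.subset_ball c hc hzc)
  have hcz' := mem_ball.1 (h.subset_ball c' hc' hzc')
  linarith [h.scale_pos, h.pairwise hc hc' hne, mem_ball.1 hzy, mem_ball'.1 hzy',
    dist_triangle4 c z y z', dist_triangle c z' c']

theorem spreadMeasure_real_univ (h : IsPieceFamily m E δ s C p Z F) :
    (spreadMeasure m Z F w).real univ = ∑ c ∈ Z, (w c : ℝ) := by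
  rw [spreadMeasure_real_apply]
  refine Finset.sum_congr rfl fun c hc => ?_
  have hpos := ENNReal.toReal_pos_iff.1 (h.measure_pos c hc)
  have := ProbabilityTheory.cond_isProbabilityMeasure_of_finite hpos.1.ne' hpos.2.ne
  rw [probReal_univ, mul_one]

variable [BorelSpace Ω]

theorem cond_real_eq_zero (h : IsPieceFamily m E δ s C p Z F) {c : Ω} (hc : c ∈ Z) {A : Set Ω}
    (hA : ¬(F c ∩ A).Nonempty) : (m[|F c]).real A = 0 := by
  rw [measureReal_def, ProbabilityTheory.cond_apply (h.isOpen c hc).measurableSet,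
    not_nonempty_iff_eq_empty.1 hA, measure_empty, mul_zero, ENNReal.toReal_zero]

theorem hasBoundedDensityOn (h : IsPieceFamily m E δ s C p Z F) :
    HasBoundedDensityOn (spreadMeasure m Z F w) m (⋃ c ∈ Z, F c) :=
  HasBoundedDensityOn.sum fun c hc =>
    (hasBoundedDensityOn_cond (h.isOpen c hc) (h.measure_pos c hc)).smul (w c)

theorem spreadMeasure_real_le_sum (h : IsPieceFamily m E δ s C p Z F) (A : Set Ω)
    [DecidablePred fun c => (F c ∩ A).Nonempty] :
    (spreadMeasure m Z F w).real A ≤ ∑ c ∈ Z with (F c ∩ A).Nonempty, (w c : ℝ) := by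
  rw [spreadMeasure_real_apply, Finset.sum_filter]
  refine Finset.sum_le_sum fun c hc => ?_
  split_ifs with hne
  · exact mul_le_of_le_one_right (w c).coe_nonneg measureReal_le_one
  · rw [h.cond_real_eq_zero hc hne, mul_zero]

theorem spreadMeasure_real_ball_le_of_ge [IsFiniteMeasure m] {a b : ℝ}
    (h : IsPieceFamily m E δ s C p Z F) (hm : IsAhlforsRegular m δ a b) (hp : p ≤ 2) (hL : 0 ≤ L)
    (hw : ∀ c ∈ Z, w c ≤ L * p ^ δ) (hr : p / 2 ≤ r) :
    (spreadMeasure m Z F w).real (ball y r) ≤ L * (b / a * 8 ^ δ) * r ^ δ := by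
  classical
  have ha := hm.lower_pos
  have hp0 := h.scale_pos
  have hr0 : 0 < r := by linarith
  set T := {c ∈ Z | (F c ∩ ball y r).Nonempty}
  have hTZ : T ⊆ Z := Finset.filter_subset _ _
  have hcard : T.card * (a * (p / 2) ^ δ) ≤ m.real (ball y (4 * r)) := by
    refine hm.card_mul_le_measureReal hp0 hp
      ((h.mono hTZ).pairwise.mono' fun c c' hcc' => by linarith) fun c hc => ?_
    obtain ⟨z, hzF, hzy⟩ := (Finset.mem_filter.1 hc).2
    have hcz := mem_ball'.1 (h.subset_ball c (hTZ hc) hzF)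
    exact ball_subset_ball' (by linarith [dist_triangle c z y, mem_ball.1 hzy])
  calc (spreadMeasure m Z F w).real (ball y r) ≤ ∑ c ∈ T, (w c : ℝ) := h.spreadMeasure_real_le_sum _
    _ ≤ T.card * (L * p ^ δ) := by
      rw [← nsmul_eq_mul]
      exact Finset.sum_le_card_nsmul _ _ _ fun c hc => hw c (hTZ hc)
    _ = L * 2 ^ δ / a * (T.card * (a * (p / 2) ^ δ)) := by
      rw [Real.div_rpow hp0.le zero_le_two]
      field_simp
    _ ≤ L * 2 ^ δ / a * (b * (4 * r) ^ δ) := by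
      refine mul_le_mul_of_nonneg_left (hcard.trans (hm.upper _ _ (by positivity))) ?_
      positivity
    _ = L * (b / a * 8 ^ δ) * r ^ δ := by
      rw [Real.mul_rpow (by norm_num) hr0.le, show (8 : ℝ) = 2 * 4 by norm_num,
        Real.mul_rpow (by norm_num) (by norm_num)]
      ring

theorem spreadMeasure_real_ball_le_of_le (h : IsPieceFamily m E δ s C p Z F) (hL : 0 ≤ L)
    (hC : 0 ≤ C) (hw : ∀ c ∈ Z, w c ≤ L * p ^ δ) (hr0 : 0 < r) (hr : r ≤ p / 2) :
    (spreadMeasure m Z F w).real (ball y r) ≤ L * C * r ^ s := by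
  rw [spreadMeasure_real_apply]
  by_cases hex : ∃ c ∈ Z, (F c ∩ ball y r).Nonempty
  · obtain ⟨c, hc, hne⟩ := hex
    rw [Finset.sum_eq_single_of_mem c hc fun c' hc' hcc' => by
      rw [h.cond_real_eq_zero hc' fun hne' =>
        hcc' (h.subsingleton_meeting_ball hr ⟨hc', hne'⟩ ⟨hc, hne⟩), mul_zero]]
    calc w c * (m[|F c]).real (ball y r) ≤ L * p ^ δ * (m[|F c]).real (ball y r) := by
          gcongr
          exact hw c hc
      _ = L * ((m[|F c]).real (ball y r) * p ^ δ) := by ring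
      _ ≤ L * (C * r ^ s) :=
          mul_le_mul_of_nonneg_left (h.growth c hc y r hr0 (by linarith)) hL
      _ = L * C * r ^ s := by ring
  · push Not at hex
    rw [Finset.sum_eq_zero fun c hc => by
      rw [h.cond_real_eq_zero hc (not_nonempty_iff_eq_empty.2 (hex c hc)), mul_zero]]
    positivity

end IsPieceFamily

end Spreading

section Weights

variable {Ω : Type*} [PseudoMetricSpace Ω]

open Classical in
/-- The points of `Z` at distance less than `τ` from `y`. -/
noncomputable def nearby (Z : Finset Ω) (τ : ℝ) (y : Ω) : Finset Ω :=
  {c ∈ Z | y ∈ ball c τ}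

theorem mem_nearby {Z : Finset Ω} {τ : ℝ} {y c : Ω} : c ∈ nearby Z τ y ↔ c ∈ Z ∧ y ∈ ball c τ := by
  classical exact Finset.mem_filter

theorem nearby_subset {Z : Finset Ω} {τ : ℝ} {y : Ω} : nearby Z τ y ⊆ Z :=
  fun _ hc => (mem_nearby.1 hc).1

theorem sum_indicator_ball (Z : Finset Ω) (τ : ℝ) (f : Ω → ℝ≥0∞) (y : Ω) :
    ∑ c ∈ Z, (ball c τ).indicator f y = (nearby Z τ y).card * f y := by
  classical
  simp only [nearby, indicator_apply, ← Finset.sum_filter, Finset.sum_const, nsmul_eq_mul]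

variable [MeasurableSpace Ω] {μ : Measure Ω} {Z T : Finset Ω} {τ k : ℝ}

/-- The mass received by `c ∈ Z` when every point shares its mass equally among the points of `Z`
at distance less than `τ`. -/
noncomputable def sharedMass (μ : Measure Ω) (Z : Finset Ω) (τ : ℝ) (c : Ω) : ℝ≥0∞ :=
  ∫⁻ y in ball c τ, ((nearby Z τ y).card : ℝ≥0∞)⁻¹ ∂μ

theorem sharedMass_le (h : ∀ᵐ y ∂μ, k ≤ (nearby Z τ y).card) (c : Ω) :
    sharedMass μ Z τ c ≤ (ENNReal.ofReal k)⁻¹ * μ (ball c τ) := by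
  rw [← setLIntegral_const]
  refine lintegral_mono_ae (ae_restrict_of_ae (h.mono fun y hy => ?_))
  rw [ENNReal.inv_le_inv, ← ENNReal.ofReal_natCast]
  exact ENNReal.ofReal_le_ofReal hy

variable [OpensMeasurableSpace Ω]

theorem measurable_card_nearby (Z : Finset Ω) (τ : ℝ) :
    Measurable fun y => ((nearby Z τ y).card : ℝ≥0∞) := by
  have h : (fun y => ((nearby Z τ y).card : ℝ≥0∞)) = fun y => ∑ c ∈ Z, (ball c τ).indicator 1 y :=
    funext fun y => by rw [sum_indicator_ball, Pi.one_apply, mul_one]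
  rw [h]
  exact Finset.measurable_fun_sum _ fun c _ => measurable_one.indicator measurableSet_ball

theorem sum_sharedMass (μ : Measure Ω) (Z T : Finset Ω) (τ : ℝ) :
    ∑ c ∈ T, sharedMass μ Z τ c = ∫⁻ y, ((nearby T τ y).card : ℝ≥0∞) *
      ((nearby Z τ y).card : ℝ≥0∞)⁻¹ ∂μ := by
  have hN := (measurable_card_nearby Z τ).inv
  calc ∑ c ∈ T, sharedMass μ Z τ c = ∑ c ∈ T, ∫⁻ y, (ball c τ).indicator
        (fun y => ((nearby Z τ y).card : ℝ≥0∞)⁻¹) y ∂μ :=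
      Finset.sum_congr rfl fun c _ => (lintegral_indicator measurableSet_ball _).symm
    _ = ∫⁻ y, ∑ c ∈ T, (ball c τ).indicator
        (fun y => ((nearby Z τ y).card : ℝ≥0∞)⁻¹) y ∂μ :=
      (lintegral_finsetSum _ fun c _ => hN.indicator measurableSet_ball).symm
    _ = _ := lintegral_congr fun y => sum_indicator_ball T τ _ y

theorem sum_sharedMass_le (hT : T ⊆ Z) :
    ∑ c ∈ T, sharedMass μ Z τ c ≤ μ (⋃ c ∈ T, ball c τ) := by
  rw [sum_sharedMass, ← lintegral_indicator_one
    (T.measurableSet_biUnion fun c _ => measurableSet_ball)]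
  refine lintegral_mono fun y => ?_
  by_cases hy : y ∈ ⋃ c ∈ T, ball c τ
  · rw [indicator_of_mem hy, Pi.one_apply, ← div_eq_mul_inv]
    refine ENNReal.div_le_of_le_mul ?_
    rw [one_mul]
    exact Nat.cast_le.2 (Finset.card_le_card fun c hc =>
      mem_nearby.2 ((mem_nearby.1 hc).imp_left (hT ·)))
  · have : nearby T τ y = ∅ := by
      simpa [nearby, Finset.filter_eq_empty_iff] using hy
    simp [this]

theorem sum_sharedMass_self (h : ∀ᵐ y ∂μ, (nearby Z τ y).Nonempty) :
    ∑ c ∈ Z, sharedMass μ Z τ c = μ univ := by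
  rw [sum_sharedMass, ← lintegral_one]
  refine lintegral_congr_ae (h.mono fun y hy => ?_)
  exact ENNReal.mul_inv_cancel (Nat.cast_ne_zero.2 hy.card_ne_zero) (ENNReal.natCast_ne_top _)

theorem exists_weights [IsFiniteMeasure μ] (hk : 0 < k)
    (h : ∀ᵐ y ∂μ, k ≤ (nearby Z τ y).card) :
    ∃ w : Ω → ℝ≥0, ∑ c ∈ Z, (w c : ℝ) = μ.real univ ∧
      (∀ T ⊆ Z, ∑ c ∈ T, (w c : ℝ) ≤ μ.real (⋃ c ∈ T, ball c τ)) ∧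
      ∀ c, w c * k ≤ μ.real (ball c τ) := by
  have hle := sharedMass_le h
  have hfin : ∀ c, sharedMass μ Z τ c ≠ ⊤ := fun c => ((hle c).trans_lt (ENNReal.mul_lt_top
    (ENNReal.inv_lt_top.2 (ENNReal.ofReal_pos.2 hk)) (measure_lt_top _ _))).ne
  have hne : ∀ᵐ y ∂μ, (nearby Z τ y).Nonempty :=
    h.mono fun y hy => Finset.card_pos.1 (Nat.cast_pos.1 (hk.trans_le hy))
  have hsum : ∀ T : Finset Ω, ∑ c ∈ T, ((sharedMass μ Z τ c).toNNReal : ℝ) =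
      (∑ c ∈ T, sharedMass μ Z τ c).toReal := fun T =>
    (ENNReal.toReal_sum fun c _ => hfin c).symm
  refine ⟨fun c => (sharedMass μ Z τ c).toNNReal, ?_, fun T hT => ?_, fun c => ?_⟩
  · rw [hsum, sum_sharedMass_self hne, measureReal_def]
  · rw [hsum]
    exact ENNReal.toReal_mono (measure_ne_top _ _) (sum_sharedMass_le hT)
  · have := ENNReal.toReal_mono (ENNReal.mul_ne_top
      (ENNReal.inv_ne_top.2 (ENNReal.ofReal_pos.2 hk).ne') (measure_ne_top _ _)) (hle c)
    rw [ENNReal.toReal_mul, ENNReal.toReal_inv, ENNReal.toReal_ofReal hk.le] at this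
    rwa [← le_div_iff₀ hk, div_eq_inv_mul]

end Weights

section Relocation

variable {Ω : Type*} [MetricSpace Ω] [MeasurableSpace Ω] {m μ ν ν' : Measure Ω}
  {E : ℕ → Set Ω} {K U V V' : Set Ω} {δ a b s τ k k' : ℝ}

/-- At arbitrarily fine scales `p`, infinitely many of the sets `E n` contain so many well
separated pieces of size `p`, with growth exponent `s`, that the pieces near any point account for a
fixed proportion of the mass of a small ball. -/
def HasSpreading (m : Measure Ω) (E : ℕ → Set Ω) (δ s : ℝ) : Prop :=
  ∃ κ > 0, ∃ C > 0, ∃ t₀ > 0, ∀ (X : Finset Ω) (t : ℝ), 0 < t → t ≤ t₀ → ∀ η > 0,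
    ∃ᶠ n in atTop, ∃ p < η, ∃ Z F, IsPieceFamily m (E n) δ s C p Z F ∧
      ∀ x ∈ X, κ * t ^ δ ≤ (nearby Z (2 * t) x).card * p ^ δ

/-- `ν` arises from `k` copies of the part of `μ` on `K` by moving mass over a distance at most
`2 * τ`, into the open set `V`. -/
structure IsRelocation (m μ ν : Measure Ω) (K V : Set Ω) (τ k : ℝ) : Prop where
  density : HasBoundedDensityOn ν m V
  mass : k * μ.real K ≤ ν.real univ
  real_ball_le : ∀ y r, ν.real (ball y r) ≤ k * μ.real (ball y (r + 2 * τ))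

namespace IsRelocation

theorem zero : IsRelocation m μ 0 K ∅ τ 0 :=
  ⟨.zero, by simp, fun y r => by simp⟩

theorem add [IsFiniteMeasure m] (h : IsRelocation m μ ν K V τ k)
    (h' : IsRelocation m μ ν' K V' τ k') :
    IsRelocation m μ (ν + ν') K (V ∪ V') τ (k + k') := by
  have := h.density.isFiniteMeasure
  have := h'.density.isFiniteMeasure
  refine ⟨h.density.add h'.density, ?_, fun y r => ?_⟩
  · rw [measureReal_add_apply, add_mul]
    exact add_le_add h.mass h'.mass
  · rw [measureReal_add_apply, add_mul]
    exact add_le_add (h.real_ball_le y r) (h'.real_ball_le y r)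

theorem smul (h : IsRelocation m μ ν K V τ k) (c : ℝ≥0) :
    IsRelocation m μ (c • ν) K V τ (c * k) := by
  refine ⟨h.density.smul c, ?_, fun y r => ?_⟩
  · rw [measureReal_nnreal_smul_apply, mul_assoc]
    exact mul_le_mul_of_nonneg_left h.mass c.coe_nonneg
  · rw [measureReal_nnreal_smul_apply, mul_assoc]
    exact mul_le_mul_of_nonneg_left (h.real_ball_le y r) c.coe_nonneg

end IsRelocation

variable [BorelSpace Ω]

theorem IsPieceFamily.isRelocation [IsFiniteMeasure μ] {A : Set Ω} {C p : ℝ} {Z : Finset Ω}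
    {F : Ω → Set Ω} (h : IsPieceFamily m A δ s C p Z F) (hp : p ≤ 2 * τ) {w : Ω → ℝ≥0}
    (hsum : ∑ c ∈ Z, (w c : ℝ) = μ.real K)
    (hw : ∀ T ⊆ Z, ∑ c ∈ T, (w c : ℝ) ≤ μ.real (⋃ c ∈ T, ball c τ)) :
    IsRelocation m μ (spreadMeasure m Z F w) K (⋃ c ∈ Z, F c) τ 1 := by
  classical
  refine ⟨h.hasBoundedDensityOn, by rw [h.spreadMeasure_real_univ, one_mul, hsum], fun y r => ?_⟩
  rw [one_mul]
  refine (h.spreadMeasure_real_le_sum _).trans ((hw _ (Finset.filter_subset _ _)).trans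
    (measureReal_mono (iUnion₂_subset fun c hc => ?_)))
  obtain ⟨hcZ, z, hzc, hzy⟩ := Finset.mem_filter.1 hc
  have hcz := mem_ball'.1 (h.subset_ball c hcZ hzc)
  exact ball_subset_ball' (by linarith [dist_triangle c z y, mem_ball.1 hzy])

variable [IsFiniteMeasure m]

theorem HasSpreading.exists_isPieceFamily (hm : IsAhlforsRegular m δ a b)
    (hE : HasSpreading m E δ s) :
    ∃ κ > 0, ∃ C > 0, ∃ τ₀ > 0, ∀ (K U : Set Ω) (τ : ℝ), 0 < τ → τ ≤ τ₀ →
      thickening (2 * τ) K ⊆ U → ∀ η > 0, ∃ᶠ n in atTop, ∃ p < η, ∃ Z F,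
        IsPieceFamily m (U ∩ E n) δ s C p Z F ∧
          ∀ y ∈ K, κ * τ ^ δ ≤ (nearby Z τ y).card * p ^ δ := by
  classical
  obtain ⟨κ, hκ, C, hC, t₀, ht₀, h⟩ := hE
  refine ⟨κ / 4 ^ δ, by positivity, C, hC, 4 * t₀, by positivity, fun K U τ hτ hττ₀ hKU η hη => ?_⟩
  obtain ⟨X, -, -, hX⟩ := hm.exists_finset_separated_net K (half_pos hτ)
  refine (h X (τ / 4) (by positivity) (by linarith) (min η τ) (lt_min hη hτ)).mono ?_
  rintro n ⟨p, hp, Z, F, hF, hcard⟩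
  refine ⟨p, hp.trans_le (min_le_left _ _), {c ∈ Z | c ∈ thickening τ K}, F,
    { hF.mono (Finset.filter_subset _ _) with closure_subset := fun c hc z hz => ?_ },
    fun y hy => ?_⟩
  · obtain ⟨hcZ, hcK⟩ := Finset.mem_filter.1 hc
    obtain ⟨y, hy, hcy⟩ := mem_thickening_iff.1 hcK
    have hzc := mem_closedBall.1 (closure_ball_subset_closedBall
      (closure_mono (hF.subset_ball c hcZ) hz))
    have hpτ := hp.trans_le (min_le_right _ _)
    exact ⟨hKU (mem_thickening_iff.2 ⟨y, hy, by linarith [dist_triangle z c y]⟩),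
      hF.closure_subset c hcZ hz⟩
  · obtain ⟨x, hx, hyx⟩ := hX y hy
    have hsub : nearby Z (2 * (τ / 4)) x ⊆ nearby {c ∈ Z | c ∈ thickening τ K} τ y := by
      intro c hc
      obtain ⟨hcZ, hxc⟩ := mem_nearby.1 hc
      have hyc : dist y c < τ := by linarith [dist_triangle y x c, mem_ball.1 hxc]
      refine mem_nearby.2 ⟨Finset.mem_filter.2 ⟨hcZ, mem_thickening_iff.2 ⟨y, hy, ?_⟩⟩, hyc⟩
      rwa [dist_comm]
    have hp := hF.scale_pos
    calc κ / 4 ^ δ * τ ^ δ = κ * (τ / 4) ^ δ := by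
          rw [Real.div_rpow hτ.le (by norm_num)]
          ring
      _ ≤ (nearby Z (2 * (τ / 4)) x).card * p ^ δ := hcard x hx
      _ ≤ _ := by gcongr

theorem HasSpreading.exists_isRelocation (hm : IsAhlforsRegular m δ a b) (hE : HasSpreading m E δ s)
    (hμ : HasBoundedDensityOn μ m U) :
    ∃ L > 0, ∃ τ₀ > 0, ∀ (K : Set Ω) (τ : ℝ), MeasurableSet K → 0 < τ → τ ≤ τ₀ →
      thickening (2 * τ) K ⊆ U → ∀ η > 0, ∃ᶠ n in atTop, ∃ p < η, ∃ ν V,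
        IsRelocation m μ ν K V τ 1 ∧ closure V ⊆ U ∩ E n ∧
        (∀ y r, p ≤ r → ν.real (ball y r) ≤ L * r ^ δ) ∧
        ∀ y r, 0 < r → r ≤ p → ν.real (ball y r) ≤ L * r ^ s := by
  have := hμ.isFiniteMeasure
  have ha := hm.lower_pos
  have hb := hm.upper_pos
  obtain ⟨κ, hκ, C, hC, τ₀, hτ₀, h⟩ := hE.exists_isPieceFamily hm
  obtain ⟨G, hG, hμG⟩ := hμ.exists_real_ball_le hm
  have hrestrict : ∀ K A, (μ.restrict K).real A ≤ μ.real A := fun K A =>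
    ENNReal.toReal_mono (measure_ne_top _ _) (Measure.restrict_le_self A)
  set L := G / κ
  refine ⟨max (L * (b / a * 8 ^ δ)) (L * C), lt_max_of_lt_left (by positivity), τ₀, hτ₀,
    fun K τ hK hτ hττ₀ hKU η hη => ?_⟩
  refine (h K U τ hτ hττ₀ hKU (min η (min 2 (2 * τ))) (by positivity)).mono ?_
  rintro n ⟨p, hpη, Z, F, hF, hcard⟩
  have hp := hF.scale_pos
  obtain ⟨hpη, hp2, hpτ⟩ : p < η ∧ p < 2 ∧ p < 2 * τ := by simpa only [lt_min_iff] using hpη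
  have hk : 0 < κ * τ ^ δ / p ^ δ := by positivity
  obtain ⟨w, hsum, hwT, hw⟩ := exists_weights (μ := μ.restrict K) hk
    ((ae_restrict_iff' hK).2 (Eventually.of_forall fun y hy =>
      (div_le_iff₀ (by positivity)).2 (hcard y hy)))
  have hwL : ∀ c ∈ Z, (w c : ℝ) ≤ L * p ^ δ := fun c _ => by
    have := (hw c).trans ((hrestrict K _).trans (hμG c τ hτ))
    rw [← le_div_iff₀ hk] at this
    refine this.trans_eq ?_
    simp only [L]
    field_simp
  refine ⟨p / 2, by linarith, spreadMeasure m Z F w, ⋃ c ∈ Z, F c,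
    hF.isRelocation hpτ.le (by rw [hsum, measureReal_restrict_apply_univ])
      fun T hT => (hwT T hT).trans (hrestrict K _),
    hF.closure_biUnion_subset, fun y r hr => ?_, fun y r hr0 hr => ?_⟩
  · have hr0 : 0 < r := by linarith
    refine (hF.spreadMeasure_real_ball_le_of_ge hm hp2.le (by positivity) hwL hr).trans ?_
    gcongr
    exact le_max_left _ _
  · refine (hF.spreadMeasure_real_ball_le_of_le (by positivity) hC.le hwL hr0 hr).trans ?_
    gcongr
    exact le_max_right _ _

end Relocation

section Refinement

variable {Ω : Type*} [MetricSpace Ω] [MeasurableSpace Ω] [BorelSpace Ω] {m μ : Measure Ω}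
  {E : ℕ → Set Ω} {U : Set Ω} {δ a b s : ℝ}

theorem HasBoundedDensityOn.exists_isCompact_thickening_subset [CompactSpace Ω]
    [IsFiniteMeasure m] (hμ : HasBoundedDensityOn μ m U) {x ζ : ℝ} (hx₀ : 0 ≤ x)
    (hx : x < μ.real univ) (hζ : 0 < ζ) :
    ∃ K, IsCompact K ∧ x < μ.real K ∧ ∃ τ > 0, τ < ζ ∧ thickening (2 * τ) K ⊆ U := by
  have := hμ.isFiniteMeasure
  have hlt : ENNReal.ofReal x < μ U := by
    rw [measure_of_measure_compl_eq_zero hμ.measure_compl]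
    exact (ENNReal.ofReal_lt_iff_lt_toReal hx₀ (measure_ne_top _ _)).2 hx
  obtain ⟨K, hKU, hK, hxK⟩ := hμ.isOpen.exists_lt_isClosed hlt
  obtain ⟨r, hr, hrU⟩ := hK.isCompact.exists_thickening_subset_open hμ.isOpen hKU
  refine ⟨K, hK.isCompact, (ENNReal.ofReal_lt_iff_lt_toReal hx₀ (measure_ne_top _ _)).1 hxK,
    min (r / 2) (ζ / 2), by positivity, (min_le_right _ _).trans_lt (half_lt_self hζ),
    (thickening_mono ?_ K).trans hrU⟩
  linarith [min_le_left (r / 2) (ζ / 2)]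

variable [IsFiniteMeasure m]

/- Each new summand is chosen at a scale at which the previous ones are already negligible, so the
large constant `L` enters the growth bound only once. -/
theorem HasSpreading.exists_isRelocation_nat (hm : IsAhlforsRegular m δ a b)
    (hE : HasSpreading m E δ s) (hs : s < δ) (hμ : HasBoundedDensityOn μ m U) :
    ∃ L > 0, ∃ τ₀ > 0, ∀ (K : Set Ω) (τ : ℝ), MeasurableSet K → 0 < τ → τ ≤ τ₀ →
      thickening (2 * τ) K ⊆ U → ∀ (N : ℕ) (e r₀ : ℝ), 0 < e →
      (∀ r, 0 < r → r < r₀ → L * r ^ δ ≤ e * r ^ s) → ∀ k : ℕ, ∃ ν V,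
        IsRelocation m μ ν K V τ k ∧ closure V ⊆ U ∩ ⋃ n ≥ N, E n ∧
        ∀ y r, 0 < r → r < r₀ → ν.real (ball y r) ≤ (k * e + L) * r ^ s := by
  obtain ⟨L, hL, τ₀, hτ₀, h⟩ := hE.exists_isRelocation hm hμ
  refine ⟨L, hL, τ₀, hτ₀, fun K τ hK hτ hττ₀ hKU N e r₀ he hLe k => ?_⟩
  induction k with
  | zero => exact ⟨0, ∅, by simpa using IsRelocation.zero, by simp, fun y r hr _ => by
      simp only [measureReal_zero, Pi.zero_apply]; positivity⟩
  | succ k ih =>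
    obtain ⟨ν, V, hν, hV, hgrowth⟩ := ih
    obtain ⟨t, ht, hsmall⟩ := hν.density.exists_real_ball_le_rpow hm hs he
    obtain ⟨n, hn, p, hpt, ν', V', hν', hV', hcoarse, hfine⟩ :=
      frequently_atTop.1 (h K τ hK hτ hττ₀ hKU t ht) N
    have := hν.density.isFiniteMeasure
    have := hν'.density.isFiniteMeasure
    refine ⟨ν + ν', V ∪ V', by simpa using hν.add hν', ?_, fun y r hr hrr₀ => ?_⟩
    · rw [closure_union]
      exact union_subset hV (hV'.trans (inter_subset_inter_right _
        (subset_iUnion₂_of_subset n hn subset_rfl)))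
    · rw [measureReal_add_apply]
      push_cast
      rcases le_total r p with hrp | hrp
      · have hke : 0 ≤ k * e * r ^ s := by positivity
        linarith [hsmall y r hr (hrp.trans_lt hpt), hfine y r hr hrp]
      · linarith [hgrowth y r hr hrr₀, hcoarse y r hrp, hLe r hr hrr₀]

variable [CompactSpace Ω]

theorem HasSpreading.exists_refinement (hm : IsAhlforsRegular m δ a b)
    (hE : HasSpreading m E δ s) (hs : s < δ) (hμ : HasBoundedDensityOn μ m U) (N : ℕ)
    {x θ ε : ℝ} (hx₀ : 0 ≤ x) (hx : x < μ.real univ) (hθ : 0 < θ) (hε : 0 < ε) :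
    ∃ ν V, HasBoundedDensityOn ν m V ∧ closure V ⊆ U ∩ ⋃ n ≥ N, E n ∧ x < ν.real univ ∧
      ∀ y r, 0 < r → ν.real (ball y r) ≤ ε * r ^ s ∨
        ν.real (ball y r) ≤ μ.real (ball y ((1 + θ) * r)) := by
  have := hμ.isFiniteMeasure
  obtain ⟨L, hL, τ₀, hτ₀, h⟩ := hE.exists_isRelocation_nat hm hs hμ
  obtain ⟨r₀, hr₀, hLε⟩ := exists_rpow_le_rpow hs L (half_pos hε)
  obtain ⟨K, hK, hxK, τ, hτ, hτζ, hKU⟩ := hμ.exists_isCompact_thickening_subset hx₀ hx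
    (show 0 < min τ₀ (θ * r₀ / 2) by positivity)
  obtain ⟨hττ₀, hτθ⟩ := lt_min_iff.1 hτζ
  obtain ⟨k, hk⟩ := exists_nat_gt (L / (ε / 2))
  have hk₀ : (0 : ℝ) < k := lt_trans (by positivity) hk
  have hkL : L ≤ k * (ε / 2) := ((div_lt_iff₀ (half_pos hε)).1 hk).le
  obtain ⟨ν, V, hν, hV, hgrowth⟩ :=
    h K τ hK.measurableSet hτ hττ₀.le hKU N (ε / 2) r₀ (half_pos hε) hLε k
  have hinv : ((k : ℝ≥0)⁻¹ : ℝ≥0) * (k : ℝ) = 1 := by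
    rw [NNReal.coe_inv, NNReal.coe_natCast, inv_mul_cancel₀ hk₀.ne']
  have hν' := hν.smul (k : ℝ≥0)⁻¹
  rw [hinv] at hν'
  refine ⟨(k : ℝ≥0)⁻¹ • ν, V, hν'.density, hV, ?_, fun y r hr => ?_⟩
  · exact hxK.trans_le (by simpa only [one_mul] using hν'.mass)
  rcases lt_or_ge r r₀ with hrr₀ | hrr₀
  · left
    rw [measureReal_nnreal_smul_apply]
    calc ((k : ℝ≥0)⁻¹ : ℝ≥0) * ν.real (ball y r)
        ≤ ((k : ℝ≥0)⁻¹ : ℝ≥0) * ((k * (ε / 2) + k * (ε / 2)) * r ^ s) := by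
          refine mul_le_mul_of_nonneg_left ((hgrowth y r hr hrr₀).trans ?_) NNReal.zero_le_coe
          gcongr
      _ = ((k : ℝ≥0)⁻¹ : ℝ≥0) * (k : ℝ) * (ε * r ^ s) := by ring
      _ = ε * r ^ s := by rw [hinv, one_mul]
  · right
    refine (hν'.real_ball_le y r).trans ?_
    rw [one_mul]
    exact measureReal_mono (ball_subset_ball (by nlinarith))

end Refinement

section MassDistribution

variable {Ω : Type*} [MetricSpace Ω] [MeasurableSpace Ω] {m μ : Measure Ω} {E : ℕ → Set Ω}
  {U : Set Ω} {δ a b s ε r₀ : ℝ}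

/-- A stage of the construction of a measure of growth exponent `s` on a limsup set: `μ` has bounded
density, is carried by the open set `U`, and retains more than half of the mass of `m`. The factor
`A`, which stays below `2`, absorbs the small distances over which mass has been moved so far. -/
structure IsMassState (m μ : Measure Ω) (U : Set Ω) (s ε r₀ : ℝ) : Prop where
  density : HasBoundedDensityOn μ m U
  half_lt : m.real univ / 2 < μ.real univ
  growth : ∃ A ∈ Ico (1 : ℝ) 2, ∀ y r, 0 < r → A * r ≤ r₀ → μ.real (ball y r) ≤ ε * (A * r) ^ s

theorem IsMassState.real_ball_le (h : IsMassState m μ U s ε r₀) (hs : 0 ≤ s) (hε : 0 < ε) (y : Ω)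
    {r : ℝ} (hr : 0 < r) (hrr₀ : r ≤ r₀ / 2) : μ.real (ball y r) ≤ ε * 2 ^ s * r ^ s := by
  obtain ⟨A, ⟨hA1, hA2⟩, hA⟩ := h.growth
  calc μ.real (ball y r) ≤ ε * (A * r) ^ s := hA y r hr (by nlinarith)
    _ ≤ ε * (2 * r) ^ s := by gcongr
    _ = ε * 2 ^ s * r ^ s := by rw [Real.mul_rpow zero_le_two hr.le, mul_assoc]

theorem IsAhlforsRegular.exists_isMassState_univ [IsFiniteMeasure m] [NeZero m]
    (hm : IsAhlforsRegular m δ a b) (hs : s < δ) (hε : 0 < ε) :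
    ∃ r₀ > 0, IsMassState m m univ s ε r₀ := by
  obtain ⟨r₀, hr₀, h⟩ := exists_rpow_le_rpow hs b hε
  refine ⟨r₀ / 2, half_pos hr₀, ⟨isOpen_univ, by simp, 1, by simp⟩,
    half_lt_self measureReal_univ_pos, 1, by norm_num, fun y r hr hrr₀ => ?_⟩
  rw [one_mul] at hrr₀ ⊢
  exact (hm.upper y r hr).trans (h r hr (by linarith))

variable [BorelSpace Ω] [IsFiniteMeasure m] [CompactSpace Ω]

theorem IsMassState.exists_next (h : IsMassState m μ U s ε r₀) (hm : IsAhlforsRegular m δ a b)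
    (hE : HasSpreading m E δ s) (hs₀ : 0 ≤ s) (hs : s < δ) (hε : 0 < ε) (N : ℕ) :
    ∃ ν V, IsMassState m ν V s ε r₀ ∧ closure V ⊆ U ∩ ⋃ n ≥ N, E n := by
  obtain ⟨A, ⟨hA1, hA2⟩, hA⟩ := h.growth
  have hA0 : 0 < A := by linarith
  set θ := (2 / A - 1) / 2 with hθ
  have hθ0 : 0 < θ := half_pos (sub_pos.2 ((one_lt_div hA0).2 hA2))
  have hAθ : A * (1 + θ) = (A + 2) / 2 := by rw [hθ]; field_simp; ring
  obtain ⟨ν, V, hν, hV, hmass, hgrowth⟩ :=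
    hE.exists_refinement hm hs h.density N (by positivity) h.half_lt hθ0 hε
  refine ⟨ν, V, ⟨hν, hmass, (A + 2) / 2, ⟨by linarith, by linarith⟩, fun y r hr hrr₀ => ?_⟩, hV⟩
  rcases hgrowth y r hr with h' | h' <;> refine h'.trans ?_
  · have : r ≤ (A + 2) / 2 * r := by nlinarith
    gcongr
  · rw [← hAθ, mul_assoc] at hrr₀ ⊢
    exact hA y _ (by positivity) hrr₀

theorem HasSpreading.exists_isMassState_seq [NeZero m] (hm : IsAhlforsRegular m δ a b)
    (hE : HasSpreading m E δ s) (hs₀ : 0 ≤ s) (hs : s < δ) (hε : 0 < ε) :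
    ∃ r₀ > 0, ∃ (μ : ℕ → Measure Ω) (U : ℕ → Set Ω), ∀ k, IsMassState m (μ k) (U k) s ε r₀ ∧
      closure (U (k + 1)) ⊆ U k ∩ ⋃ n ≥ k, E n := by
  obtain ⟨r₀, hr₀, hinit⟩ := hm.exists_isMassState_univ hs hε
  let State := {q : Measure Ω × Set Ω // IsMassState m q.1 q.2 s ε r₀}
  have hstep : ∀ (N : ℕ) (q : State), ∃ q' : State,
      closure q'.1.2 ⊆ q.1.2 ∩ ⋃ n ≥ N, E n := by
    rintro N ⟨⟨μ, U⟩, h⟩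
    obtain ⟨ν, V, h', hV⟩ := h.exists_next hm hE hs₀ hs hε N
    exact ⟨⟨⟨ν, V⟩, h'⟩, hV⟩
  choose next hnext using hstep
  let q : ℕ → State := fun k => Nat.rec ⟨⟨m, univ⟩, hinit⟩ next k
  exact ⟨r₀, hr₀, fun k => (q k).1.1, fun k => (q k).1.2, fun k => ⟨(q k).2, hnext k (q k)⟩⟩

theorem HasSpreading.le_mul_hausdorffMeasure_limsup [NeZero m] (hm : IsAhlforsRegular m δ a b)
    (hE : HasSpreading m E δ s) (hs₀ : 0 ≤ s) (hs : s < δ) (hε : 0 < ε) :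
    ENNReal.ofReal (m.real univ / 2) ≤ ENNReal.ofReal (ε * 2 ^ s) *
      Measure.hausdorffMeasure s {x | ∃ᶠ n in atTop, x ∈ E n} := by
  obtain ⟨r₀, hr₀, μ, U, h⟩ := hE.exists_isMassState_seq hm hs₀ hs hε
  have hstate : ∀ k, IsMassState m (μ (k + 1)) (U (k + 1)) s ε r₀ := fun k => (h (k + 1)).1
  have hfin : ∀ k, IsFiniteMeasure (μ (k + 1)) := fun k => (hstate k).density.isFiniteMeasure
  have hanti : Antitone fun k => closure (U (k + 1)) := antitone_nat_of_succ_le fun k =>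
    (h (k + 1)).2.trans (inter_subset_left.trans subset_closure)
  refine (le_mul_hausdorffMeasure_iInter (μ := fun k => μ (k + 1)) hanti
    (fun k => isClosed_closure.isCompact) hs₀ (by positivity) (half_pos hr₀) (fun k => ?_)
    fun k y r hr hrr₀ => (hstate k).real_ball_le hs₀ hε y hr hrr₀).trans ?_
  · calc ENNReal.ofReal (m.real univ / 2) ≤ ENNReal.ofReal ((μ (k + 1)).real univ) :=
          ENNReal.ofReal_le_ofReal (hstate k).half_lt.le
      _ = μ (k + 1) (U (k + 1)) := by
          rw [ofReal_measureReal, measure_of_measure_compl_eq_zero (hstate k).density.measure_compl]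
      _ ≤ _ := measure_mono subset_closure
  · refine mul_le_mul_right (measure_mono fun x hx => frequently_atTop.2 fun N => ?_) _
    obtain ⟨n, hn, hxn⟩ := mem_iUnion₂.1 ((h N).2 (mem_iInter.1 hx N)).2
    exact ⟨n, hn, hxn⟩

theorem HasSpreading.hausdorffMeasure_limsup_eq_top [NeZero m] (hm : IsAhlforsRegular m δ a b)
    (hE : HasSpreading m E δ s) (hs₀ : 0 ≤ s) (hs : s < δ) :
    Measure.hausdorffMeasure s {x | ∃ᶠ n in atTop, x ∈ E n} = ⊤ := by
  by_contra hne
  have hmass : 0 < m.real univ := measureReal_univ_pos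
  set M := Measure.hausdorffMeasure s {x | ∃ᶠ n in atTop, x ∈ E n}
  obtain ⟨ε, hε, hlt⟩ := exists_pos_mul_lt (half_pos hmass) (2 ^ s * M.toReal)
  have h : _ ≤ ENNReal.ofReal (ε * 2 ^ s) * M := hE.le_mul_hausdorffMeasure_limsup hm hs₀ hs hε
  rw [← ENNReal.ofReal_toReal hne, ← ENNReal.ofReal_mul (by positivity),
    ENNReal.ofReal_le_ofReal_iff (by positivity)] at h
  linarith

end MassDistribution

section ResonantPieces

variable {Ω : Type*} [MetricSpace Ω] [MeasurableSpace Ω] {m : Measure Ω} {A : Set Ω}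
  {𝒜 : Set (Set Ω)} {a b c₁ c₂ p s t γ δ κ M : ℝ}

/-- The intersection conditions for a single resonant set `A` at the scale `p`: inside a ball of
radius `r ≤ 3 * p`, the `t`-neighbourhood of `A` behaves like that of a `γ`-dimensional set. -/
structure HasIntersectionBounds (m : Measure Ω) (A : Set Ω) (p γ c₁ c₂ : ℝ) : Prop where
  lower : ∀ c ∈ A, ∀ t, 0 < t → t ≤ p →
    c₁ * m.real (ball c t) * (p / t) ^ γ ≤ m.real (ball c (p / 2) ∩ thickening t A)
  upper : ∀ c ∈ A, ∀ t, 0 < t → t ≤ p → ∀ z ∈ A, ∀ r, 0 < r → r ≤ 3 * p →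
    m.real (ball z r ∩ ball c (3 * p) ∩ thickening (3 * t) A) ≤
      c₂ * m.real (ball c t) * (r / t) ^ γ

theorem IsAhlforsRegular.exists_finset_le_card_nearby [BorelSpace Ω] [IsFiniteMeasure m]
    (hm : IsAhlforsRegular m δ a b) (T : Set Ω) (hp : 0 < p) (hκ : 0 ≤ κ) :
    ∃ Z : Finset Ω, (Z : Set Ω) ⊆ T ∧ (Z : Set Ω).Pairwise (fun c c' => 3 * p ≤ dist c c') ∧
      ∀ x t, 4 * p ≤ t → t ≤ 1 → κ * m.real (ball x t) ≤ m.real (ball x t ∩ thickening p T) →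
        κ * a / (b * 4 ^ δ) * t ^ δ ≤ (nearby Z (2 * t) x).card * p ^ δ := by
  have hb := hm.upper_pos
  obtain ⟨Z, hZT, hsep, hcov⟩ := hm.exists_finset_separated_net T (by positivity : 0 < 3 * p)
  refine ⟨Z, hZT, hsep.imp fun _ _ h => h.le, fun x t hpt ht1 hub => ?_⟩
  have ht : 0 < t := by linarith
  have hsub : ball x t ∩ thickening p T ⊆ ⋃ c ∈ nearby Z (2 * t) x, ball c (4 * p) := by
    rintro y ⟨hyx, hyT⟩
    obtain ⟨c, hc, hyc⟩ := mem_thickening_iff.1 hyT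
    obtain ⟨z, hz, hcz⟩ := hcov c hc
    have hyz : dist y z < 4 * p := by linarith [dist_triangle y c z]
    have hxz : dist x z < 2 * t := by linarith [dist_triangle x y z, mem_ball'.1 hyx]
    exact mem_biUnion (mem_nearby.2 ⟨hz, hxz⟩) hyz
  have hcount : κ * (a * t ^ δ) ≤ (nearby Z (2 * t) x).card * (b * (4 * p) ^ δ) := calc
    κ * (a * t ^ δ) ≤ κ * m.real (ball x t) := by
        have := hm.lower x t ht ht1
        gcongr
    _ ≤ m.real (⋃ c ∈ nearby Z (2 * t) x, ball c (4 * p)) :=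
        hub.trans (measureReal_mono hsub (measure_ne_top _ _))
    _ ≤ ∑ c ∈ nearby Z (2 * t) x, m.real (ball c (4 * p)) := measureReal_biUnion_finset_le _ _
    _ ≤ ∑ c ∈ nearby Z (2 * t) x, b * (4 * p) ^ δ :=
        Finset.sum_le_sum fun c _ => hm.upper c _ (by positivity)
    _ = _ := by rw [Finset.sum_const, nsmul_eq_mul]
  rw [Real.mul_rpow (by norm_num) hp.le] at hcount
  rw [div_mul_eq_mul_div, div_le_iff₀ (by positivity)]
  linarith

namespace HasIntersectionBounds

theorem rpow_mul_rpow_le (hA : HasIntersectionBounds m A p γ c₁ c₂)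
    (hm : IsAhlforsRegular m δ a b) (hc₁ : 0 < c₁) (ht : 0 < t) (htp : t ≤ p) (hp1 : p ≤ 1)
    {c : Ω} (hc : c ∈ A) :
    c₁ * a * (t ^ (δ - γ) * p ^ γ) ≤ m.real (ball c (p / 2) ∩ thickening t A) := by
  have hp := ht.trans_le htp
  calc c₁ * a * (t ^ (δ - γ) * p ^ γ) = c₁ * (a * t ^ δ) * (p / t) ^ γ := by
        rw [Real.rpow_sub ht, Real.div_rpow hp.le ht.le]
        field_simp
    _ ≤ c₁ * m.real (ball c t) * (p / t) ^ γ := by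
        have := hm.lower c t ht (htp.trans hp1)
        gcongr
    _ ≤ _ := hA.lower c hc t ht htp

variable [IsFiniteMeasure m]

theorem measureReal_ball_inter_le_of_le (hA : HasIntersectionBounds m A p γ c₁ c₂)
    (hm : IsAhlforsRegular m δ a b) (hc₂ : 0 < c₂) (ht : 0 < t) (htp : t ≤ p) {c : Ω}
    (hc : c ∈ A) (y : Ω) {r : ℝ} (htr : t ≤ r) (hrp : r ≤ p) :
    m.real (ball y r ∩ (ball c (p / 2) ∩ thickening t A)) ≤
      b * (c₂ * 3 ^ γ) * (r ^ γ * t ^ (δ - γ)) := by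
  have hb := hm.upper_pos
  have hr := ht.trans_le htr
  rcases (ball y r ∩ (ball c (p / 2) ∩ thickening t A)).eq_empty_or_nonempty with h | h
  · rw [h, measureReal_empty]
    positivity
  obtain ⟨w, hwy, -, hwA⟩ := h
  obtain ⟨z, hz, hwz⟩ := mem_thickening_iff.1 hwA
  have hsub : ball y r ∩ (ball c (p / 2) ∩ thickening t A) ⊆
      ball z (3 * r) ∩ ball c (3 * p) ∩ thickening (3 * t) A := by
    rintro v ⟨hvy, hvc, hvA⟩
    refine ⟨⟨?_, ball_subset_ball (by linarith) hvc⟩, thickening_mono (by linarith) A hvA⟩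
    rw [mem_ball]
    linarith [dist_triangle4 v y w z, mem_ball.1 hvy, mem_ball'.1 hwy]
  calc m.real (ball y r ∩ (ball c (p / 2) ∩ thickening t A))
      ≤ m.real (ball z (3 * r) ∩ ball c (3 * p) ∩ thickening (3 * t) A) := measureReal_mono hsub
    _ ≤ c₂ * m.real (ball c t) * (3 * r / t) ^ γ :=
        hA.upper c hc t ht htp z hz _ (by positivity) (by linarith)
    _ ≤ c₂ * (b * t ^ δ) * (3 * r / t) ^ γ := by
        have := hm.upper c t ht
        gcongr
    _ = _ := by
        rw [Real.rpow_sub ht, Real.div_rpow (by positivity) ht.le,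
          Real.mul_rpow (by norm_num) hr.le]
        field_simp

theorem measureReal_ball_inter_le (hA : HasIntersectionBounds m A p γ c₁ c₂)
    (hm : IsAhlforsRegular m δ a b) (hc₂ : 0 < c₂) (ht : 0 < t) (htp : t ≤ p) (hγs : γ ≤ s)
    (hsδ : s ≤ δ) {c : Ω} (hc : c ∈ A) (y : Ω) {r : ℝ} (hr : 0 < r) (hrp : r ≤ p) :
    m.real (ball y r ∩ (ball c (p / 2) ∩ thickening t A)) ≤
      b * max 1 (c₂ * 3 ^ γ) * (r ^ s * t ^ (δ - s)) := by
  have hb := hm.upper_pos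
  rcases lt_or_ge r t with hrt | htr
  · calc m.real (ball y r ∩ (ball c (p / 2) ∩ thickening t A)) ≤ m.real (ball y r) :=
          measureReal_mono inter_subset_left
      _ ≤ b * r ^ δ := hm.upper y r hr
      _ = b * 1 * (r ^ s * r ^ (δ - s)) := by rw [← Real.rpow_add hr, add_sub_cancel, mul_one]
      _ ≤ b * max 1 (c₂ * 3 ^ γ) * (r ^ s * t ^ (δ - s)) := by
          have : 0 ≤ δ - s := by linarith
          gcongr
          exact le_max_left _ _
  · have hrs : r ^ s = r ^ γ * r ^ (s - γ) := by rw [← Real.rpow_add hr, add_sub_cancel]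
    have hts : t ^ (δ - γ) = t ^ (s - γ) * t ^ (δ - s) := by
      rw [← Real.rpow_add ht, sub_add_sub_cancel']
    have htr' : t ^ (s - γ) ≤ r ^ (s - γ) := Real.rpow_le_rpow ht.le htr (by linarith)
    calc m.real (ball y r ∩ (ball c (p / 2) ∩ thickening t A))
        ≤ b * (c₂ * 3 ^ γ) * (r ^ γ * t ^ (δ - γ)) :=
          hA.measureReal_ball_inter_le_of_le hm hc₂ ht htp hc y htr hrp
      _ ≤ b * max 1 (c₂ * 3 ^ γ) * (r ^ s * t ^ (δ - s)) := by
          rw [hrs, hts, mul_assoc (r ^ γ)]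
          gcongr
          exact le_max_right _ _

theorem cond_real_ball_mul_le (hA : HasIntersectionBounds m A p γ c₁ c₂)
    (hm : IsAhlforsRegular m δ a b) (hc₁ : 0 < c₁) (hc₂ : 0 < c₂) (ht : 0 < t) (htp : t ≤ p)
    (hp1 : p ≤ 1) (hγs : γ ≤ s) (hsδ : s ≤ δ) (hM : p ^ (δ - γ) ≤ M * t ^ (s - γ)) {c : Ω}
    (hc : c ∈ A) (y : Ω) {r : ℝ} (hr : 0 < r) (hrp : r ≤ p)
    (hF : MeasurableSet (ball c (p / 2) ∩ thickening t A)) :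
    (m[|ball c (p / 2) ∩ thickening t A]).real (ball y r) * p ^ δ ≤
      M * (b * max 1 (c₂ * 3 ^ γ)) / (c₁ * a) * r ^ s := by
  have ha := hm.lower_pos
  have hb := hm.upper_pos
  have hp := ht.trans_le htp
  have hlower := hA.rpow_mul_rpow_le hm hc₁ ht htp hp1 hc
  have hupper := hA.measureReal_ball_inter_le hm hc₂ ht htp hγs hsδ hc y hr hrp
  rw [inter_comm] at hupper
  set F := ball c (p / 2) ∩ thickening t A
  set B := b * max 1 (c₂ * 3 ^ γ)
  have hB : 0 < B := by positivity
  have hts : t ^ (δ - γ) = t ^ (s - γ) * t ^ (δ - s) := by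
    rw [← Real.rpow_add ht, sub_add_sub_cancel']
  have hpδ : p ^ δ = p ^ γ * p ^ (δ - γ) := by rw [← Real.rpow_add hp, add_sub_cancel]
  rw [measureReal_def, ProbabilityTheory.cond_apply hF, ENNReal.toReal_mul, ENNReal.toReal_inv,
    ← measureReal_def, ← measureReal_def]
  calc (m.real F)⁻¹ * m.real (F ∩ ball y r) * p ^ δ
      ≤ (c₁ * a * (t ^ (δ - γ) * p ^ γ))⁻¹ * (B * (r ^ s * t ^ (δ - s))) *
          (p ^ γ * (M * t ^ (s - γ))) := by
        rw [hpδ]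
        gcongr
    _ = M * B / (c₁ * a) * r ^ s := by
        rw [hts]
        field_simp

end HasIntersectionBounds

variable [BorelSpace Ω] [IsFiniteMeasure m] {Z : Finset Ω}

theorem exists_isPieceFamily_of_hasIntersectionBounds (hm : IsAhlforsRegular m δ a b)
    (hA : ∀ A ∈ 𝒜, HasIntersectionBounds m A p γ c₁ c₂) (hc₁ : 0 < c₁) (hc₂ : 0 < c₂)
    (ht : 0 < t) (htp : t ≤ p) (hp1 : p ≤ 1) (hγs : γ ≤ s) (hsδ : s ≤ δ)
    (hM : p ^ (δ - γ) ≤ M * t ^ (s - γ)) {E : Set Ω} (hE : ∀ A ∈ 𝒜, cthickening t A ⊆ E)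
    (hZ : (Z : Set Ω) ⊆ ⋃₀ 𝒜) (hsep : (Z : Set Ω).Pairwise fun c c' => 3 * p ≤ dist c c') :
    ∃ F, IsPieceFamily m E δ s (M * (b * max 1 (c₂ * 3 ^ γ)) / (c₁ * a)) p Z F := by
  have ha := hm.lower_pos
  have hp := ht.trans_le htp
  choose! A hA𝒜 hcA using fun c (hc : c ∈ Z) => mem_sUnion.1 (hZ hc)
  have hopen : ∀ c, IsOpen (ball c (p / 2) ∩ thickening t (A c)) := fun c =>
    isOpen_ball.inter isOpen_thickening
  refine ⟨fun c => ball c (p / 2) ∩ thickening t (A c),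
    { scale_pos := hp
      pairwise := hsep
      isOpen := fun c _ => hopen c
      subset_ball := fun c _ => inter_subset_left
      closure_subset := fun c hc => (closure_mono inter_subset_right).trans
        ((closure_thickening_subset_cthickening _ _).trans (hE _ (hA𝒜 c hc)))
      measure_pos := fun c hc => lt_of_lt_of_le (by positivity)
        ((hA _ (hA𝒜 c hc)).rpow_mul_rpow_le hm hc₁ ht htp hp1 (hcA c hc))
      growth := fun c hc y r hr hrp => (hA _ (hA𝒜 c hc)).cond_real_ball_mul_le hm hc₁ hc₂ ht htp
        hp1 hγs hsδ hM (hcA c hc) y hr hrp (hopen c).measurableSet }⟩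

theorem card_mul_le_measureReal_biUnion_thickening (hm : IsAhlforsRegular m δ a b)
    (hA : ∀ A ∈ 𝒜, HasIntersectionBounds m A p γ c₁ c₂) (hc₁ : 0 < c₁) (ht : 0 < t)
    (htp : t ≤ p) (hp1 : p ≤ 1) (hZ : (Z : Set Ω) ⊆ ⋃₀ 𝒜)
    (hsep : (Z : Set Ω).Pairwise fun c c' => 3 * p ≤ dist c c') :
    Z.card * (c₁ * a * (t ^ (δ - γ) * p ^ γ)) ≤ m.real (⋃ A ∈ 𝒜, thickening t A) := by
  choose! A hA𝒜 hcA using fun c (hc : c ∈ Z) => mem_sUnion.1 (hZ hc)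
  have hdisj : (Z : Set Ω).PairwiseDisjoint fun c => ball c (p / 2) ∩ thickening t (A c) :=
    fun c hc c' hc' hne => (ball_disjoint_ball (by linarith [hsep hc hc' hne])).mono
      inter_subset_left inter_subset_left
  calc Z.card * (c₁ * a * (t ^ (δ - γ) * p ^ γ))
      = ∑ _c ∈ Z, c₁ * a * (t ^ (δ - γ) * p ^ γ) := by rw [Finset.sum_const, nsmul_eq_mul]
    _ ≤ ∑ c ∈ Z, m.real (ball c (p / 2) ∩ thickening t (A c)) := Finset.sum_le_sum fun c hc =>
        (hA _ (hA𝒜 c hc)).rpow_mul_rpow_le hm hc₁ ht htp hp1 (hcA c hc)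
    _ = m.real (⋃ c ∈ Z, ball c (p / 2) ∩ thickening t (A c)) :=
        (measureReal_biUnion_finset hdisj fun c _ =>
          (isOpen_ball.inter isOpen_thickening).measurableSet).symm
    _ ≤ _ := measureReal_mono (iUnion₂_subset fun c hc => inter_subset_right.trans
        (subset_iUnion₂_of_subset (A c) (hA𝒜 c hc) subset_rfl))
        (measure_ne_top _ _)

end ResonantPieces

section Exponents

variable {ι : Type*} {L : Filter ι} {p q : ι → ℝ} {e C τ σ : ℝ}

theorem eventually_log_div_log_mem_Icc (hp : ∀ n, 0 < p n) (hq : ∀ n, 0 < q n)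
    (hp₀ : Tendsto p L (𝓝 0)) (hlim : Tendsto (fun n => q n / p n) L (𝓝 0)) :
    ∀ᶠ n in L, q n < 1 ∧ Real.log (p n) / Real.log (q n) ∈ Icc (0 : ℝ) 1 := by
  filter_upwards [hp₀.eventually_lt_const one_pos, hlim.eventually_lt_const one_pos]
    with n hp1 hqp
  replace hqp : q n < p n := (div_lt_one (hp n)).1 hqp
  have hlogp : Real.log (p n) < 0 := Real.log_neg (hp n) hp1
  have hlog : Real.log (q n) < Real.log (p n) := Real.log_lt_log (hq n) hqp
  refine ⟨hqp.trans hp1, div_nonneg_of_nonpos hlogp.le (hlog.trans hlogp).le, ?_⟩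
  exact (div_le_one_of_neg (hlog.trans hlogp)).2 hlog.le

theorem limsup_log_div_log_nonneg [L.NeBot] (hp : ∀ n, 0 < p n) (hq : ∀ n, 0 < q n)
    (hp₀ : Tendsto p L (𝓝 0)) (hlim : Tendsto (fun n => q n / p n) L (𝓝 0)) :
    0 ≤ limsup (fun n => Real.log (p n) / Real.log (q n)) L := by
  have h := eventually_log_div_log_mem_Icc hp hq hp₀ hlim
  exact le_limsup_of_frequently_le (h.mono fun n hn => hn.2.1).frequently
    (isBoundedUnder_of_eventually_le (h.mono fun n hn => hn.2.2))

theorem frequently_le_rpow_max_zero [L.NeBot] (hp : ∀ n, 0 < p n) (hq : ∀ n, 0 < q n)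
    (hp₀ : Tendsto p L (𝓝 0)) (hlim : Tendsto (fun n => q n / p n) L (𝓝 0))
    (hτ : τ < limsup (fun n => Real.log (p n) / Real.log (q n)) L) :
    ∃ᶠ n in L, p n ≤ q n ^ max τ 0 := by
  rcases le_total τ 0 with hτ0 | hτ0
  · simpa only [max_eq_right hτ0, Real.rpow_zero] using
      (hp₀.eventually_le_const one_pos).frequently
  have h := eventually_log_div_log_mem_Icc hp hq hp₀ hlim
  have hcob : L.IsCoboundedUnder (· ≤ ·) fun n => Real.log (p n) / Real.log (q n) :=
    (isBoundedUnder_of_eventually_ge (h.mono fun n hn => hn.2.1)).isCoboundedUnder_le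
  rw [max_eq_left hτ0]
  refine ((frequently_lt_of_lt_limsup hcob hτ).and_eventually h).mono fun n hn => ?_
  rw [← Real.log_le_log_iff (hp n) (Real.rpow_pos_of_pos (hq n) τ), Real.log_rpow (hq n)]
  exact ((lt_div_iff_of_neg (Real.log_neg (hq n) hn.2.1)).1 hn.1).le

theorem exists_frequently_le_mul_rpow (hq : ∀ n, 0 < q n)
    (h : liminf (fun n => ENNReal.ofReal (p n / q n ^ σ)) L < ⊤) :
    ∃ C > 0, ∃ᶠ n in L, p n ≤ C * q n ^ σ := by
  obtain ⟨B, hB, hBtop⟩ := exists_between h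
  refine ⟨B.toReal + 1, by positivity, (frequently_lt_of_liminf_lt (by isBoundedDefault) hB).mono
    fun n hn => ?_⟩
  rw [← div_le_iff₀ (Real.rpow_pos_of_pos (hq n) σ)]
  linarith [(ENNReal.ofReal_le_iff_le_toReal hBtop.ne).1 hn.le]

theorem lt_one_of_frequently_le_mul_rpow (hp : ∀ n, 0 < p n) (hq : ∀ n, 0 < q n)
    (hp₀ : Tendsto p L (𝓝 0)) (hlim : Tendsto (fun n => q n / p n) L (𝓝 0)) (hC : 0 < C)
    (hfreq : ∃ᶠ n in L, p n ≤ C * q n ^ τ) : τ < 1 := by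
  by_contra! hτ
  obtain ⟨n, hpn, ⟨hq1, -⟩, hn⟩ := (hfreq.and_eventually
    ((eventually_log_div_log_mem_Icc hp hq hp₀ hlim).and
      (hlim.eventually_lt_const (inv_pos.2 hC)))).exists
  have hqτ : q n ^ τ ≤ q n := by
    simpa only [Real.rpow_one] using Real.rpow_le_rpow_of_exponent_ge (hq n) hq1.le hτ
  rw [div_lt_iff₀ (hp n), ← div_eq_inv_mul, lt_div_iff₀ hC] at hn
  linarith [mul_le_mul_of_nonneg_left hqτ hC.le]

theorem exists_frequently_exists_mul_rpow_le [L.NeBot] (hp : ∀ n, 0 < p n) (hq : ∀ n, 0 < q n)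
    (h : e = 0 ∨ 0 < limsup (fun n => ENNReal.ofReal (q n / p n)) L) :
    ∃ c > 0, ∃ᶠ n in L, ∃ t > 0, t ≤ p n ∧ t ≤ q n ∧ c * p n ^ e ≤ t ^ e := by
  rcases h with rfl | h
  · refine ⟨1, one_pos, Frequently.of_forall fun n => ⟨min (p n) (q n), lt_min (hp n) (hq n),
      min_le_left _ _, min_le_right _ _, by simp only [Real.rpow_zero, mul_one, le_refl]⟩⟩
  obtain ⟨B, hB, hBlim⟩ := exists_between h
  have hη : 0 < min B.toReal 1 := lt_min (ENNReal.toReal_pos hB.ne' hBlim.ne_top) one_pos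
  refine ⟨min B.toReal 1 ^ e, by positivity,
    (frequently_lt_of_lt_limsup (by isBoundedDefault) hBlim).mono fun n hn =>
      ⟨min B.toReal 1 * p n, mul_pos hη (hp n),
        mul_le_of_le_one_left (hp n).le (min_le_right _ _), ?_,
        (Real.mul_rpow hη.le (hp n).le).ge⟩⟩
  rw [← le_div_iff₀ (hp n)]
  exact (min_le_left _ _).trans ((ENNReal.lt_ofReal_iff_toReal_lt hBlim.ne_top).1 hn).le

end Exponents

section Blocks

variable {Ω J : Type*} [MetricSpace Ω] {R : J → Set Ω} {β : J → ℝ} {ρ ψ : ℝ → ℝ} {l u : ℕ → ℝ}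
  {n : ℕ} {t : ℝ}

/-- The points approximated at the rate `ψ` by some resonant set with index in the `n`-th block;
the limsup of these sets is contained in `limsupSet R β ψ`. -/
def blockSet (R : J → Set Ω) (β : J → ℝ) (ψ : ℝ → ℝ) (l u : ℕ → ℝ) (n : ℕ) : Set Ω :=
  ⋃ α ∈ indexBlock β l u n, thickening (ψ (β α)) (R α)

theorem isOpen_blockSet : IsOpen (blockSet R β ψ l u n) :=
  isOpen_biUnion fun _ _ => isOpen_thickening

theorem frequently_blockSet_subset_limsupSet (hl : Tendsto l atTop atTop) :
    {x | ∃ᶠ n in atTop, x ∈ blockSet R β ψ l u n} ⊆ limsupSet R β ψ := by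
  intro x hx hfin
  obtain ⟨M, hM⟩ := (hfin.image β).bddAbove
  obtain ⟨n, hxn, hMn⟩ := (hx.and_eventually (hl.eventually_ge_atTop M)).exists
  obtain ⟨α, hα, hxα⟩ := mem_iUnion₂.1 hxn
  linarith [hM (mem_image_of_mem β hxα), hα.1]

theorem IsApproximatingFunction.thickening_subset_blockSet (hψ : IsApproximatingFunction ψ)
    (hl : 0 < l n) (ht : t ≤ ψ (u n)) {A : Set Ω} (hA : A ∈ R '' indexBlock β l u n) :
    thickening t A ⊆ blockSet R β ψ l u n := by
  obtain ⟨α, hα, rfl⟩ := hA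
  have hβ : 0 < β α := hl.trans hα.1
  exact (thickening_mono (ht.trans (hψ.anti hβ (hβ.trans_le hα.2) hα.2)) _).trans
    (subset_iUnion₂_of_subset α hα subset_rfl)

theorem ubiquityUnion_eq_thickening :
    ubiquityUnion R β ρ l u n = thickening (ρ (u n)) (⋃₀ (R '' indexBlock β l u n)) := by
  rw [ubiquityUnion, sUnion_image, thickening_biUnion]

theorem IsLowerUpper.upper_tendsto (h : IsLowerUpper l u) : Tendsto u atTop atTop :=
  tendsto_atTop_mono (fun n => (h.lt n).le) h.lower_tendsto

theorem IsUbiquityFunction.tendsto_upper (hρ : IsUbiquityFunction ρ) (hlu : IsLowerUpper l u) :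
    Tendsto (fun n => ρ (u n)) atTop (𝓝 0) :=
  hρ.tendsto_zero.comp hlu.upper_tendsto

end Blocks

theorem measure_frequently_pos {X : Type*} [MeasurableSpace X] {m : Measure X} [IsFiniteMeasure m]
    {E : ℕ → Set X} (hE : ∀ n, MeasurableSet (E n)) {c : ℝ} (hc : 0 < c)
    (h : ∃ᶠ n in atTop, c ≤ m.real (E n)) : 0 < m {x | ∃ᶠ n in atTop, x ∈ E n} := by
  have heq : {x | ∃ᶠ n in atTop, x ∈ E n} = ⋂ N, ⋃ n ≥ N, E n := by
    ext x
    simp only [frequently_atTop, mem_ofPred_eq, mem_iInter, mem_iUnion, exists_prop]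
  have hanti : Antitone fun N => ⋃ n ≥ N, E n := fun i j hij =>
    biUnion_mono (fun n (hn : j ≤ n) => hij.trans hn) fun _ _ => subset_rfl
  have htend := tendsto_measure_iInter_atTop (μ := m)
    (fun N => (MeasurableSet.biUnion (to_countable _) fun n _ => hE n).nullMeasurableSet) hanti
    ⟨0, measure_ne_top _ _⟩
  rw [heq]
  refine lt_of_lt_of_le (ENNReal.ofReal_pos.2 hc) (ge_of_tendsto' htend fun N => ?_)
  obtain ⟨n, hn, hcn⟩ := frequently_atTop.1 h N
  calc ENNReal.ofReal c ≤ ENNReal.ofReal (m.real (E n)) := ENNReal.ofReal_le_ofReal hcn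
    _ = m (E n) := ofReal_measureReal
    _ ≤ _ := measure_mono (subset_iUnion₂_of_subset n hn subset_rfl)

section LimsupSet

variable {Ω J : Type*} [MetricSpace Ω] [MeasurableSpace Ω] {m : Measure Ω} {R : J → Set Ω}
  {β : J → ℝ} {ρ ψ : ℝ → ℝ} {l u : ℕ → ℝ} {δ γ a b s τ C M c₀ : ℝ}

theorem IntersectionConditions.exists_eventually_hasIntersectionBounds
    (h : IntersectionConditions m R β ρ u γ) (l : ℕ → ℝ) :
    ∃ c₁ > 0, ∃ c₂ > 0, ∀ᶠ n in atTop, ∀ A ∈ R '' indexBlock β l u n,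
      HasIntersectionBounds m A (ρ (u n)) γ c₁ c₂ := by
  obtain ⟨-, -, c₁, c₂, hc₁, hc₂, n₀, H⟩ := h
  refine ⟨c₁, hc₁, c₂, hc₂, (eventually_ge_atTop n₀).mono fun n hn => ?_⟩
  rintro _ ⟨α, hα, rfl⟩
  exact ⟨fun c hc t ht htp => (H n hn α hα.2 c hc t ht htp).1,
    fun c hc t ht htp => (H n hn α hα.2 c hc t ht htp).2 α⟩

variable [BorelSpace Ω] [IsFiniteMeasure m]

namespace IsLocallyUbiquitous

theorem exists_eventually_separated_centres (hub : IsLocallyUbiquitous m R β ρ l u γ)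
    (hm : IsAhlforsRegular m δ a b) (hρ : ∀ r, 0 < r → 0 < ρ r) (hu : ∀ n, 0 < u n)
    (hρ₀ : Tendsto (fun n => ρ (u n)) atTop (𝓝 0)) :
    ∃ κ > 0, ∃ t₀ > 0, ∀ (X : Finset Ω) (t : ℝ), 0 < t → t ≤ t₀ → ∀ᶠ n in atTop,
      ∃ Z : Finset Ω, (Z : Set Ω) ⊆ ⋃₀ (R '' indexBlock β l u n) ∧
        (Z : Set Ω).Pairwise (fun c c' => 3 * ρ (u n) ≤ dist c c') ∧
        ∀ x ∈ X, κ * t ^ δ ≤ (nearby Z (2 * t) x).card * ρ (u n) ^ δ := by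
  obtain ⟨⟨κ, r₀, hκ, hr₀, hloc⟩, -⟩ := hub
  have ha := hm.lower_pos
  have hb := hm.upper_pos
  refine ⟨κ * a / (b * 4 ^ δ), by positivity, min r₀ 1, by positivity, fun X t ht htt => ?_⟩
  have hlocX : ∀ᶠ n in atTop, ∀ x ∈ X,
      κ * m.real (ball x t) ≤ m.real (ball x t ∩ ubiquityUnion R β ρ l u n) :=
    X.eventually_all.2 fun x _ =>
      let ⟨n₀, hn₀⟩ := hloc x t ht (htt.trans (min_le_left _ _))
      (eventually_ge_atTop n₀).mono hn₀
  filter_upwards [hlocX, hρ₀.eventually_lt_const (by positivity : 0 < t / 4)] with n hn hρt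
  obtain ⟨Z, hZR, hsep, hcard⟩ :=
    hm.exists_finset_le_card_nearby (⋃₀ (R '' indexBlock β l u n)) (hρ _ (hu n)) hκ.le
  refine ⟨Z, hZR, hsep, fun x hx => hcard x t (by linarith) (htt.trans (min_le_right _ _)) ?_⟩
  rw [← ubiquityUnion_eq_thickening]
  exact hn x hx

theorem hasSpreading (hub : IsLocallyUbiquitous m R β ρ l u γ) (hm : IsAhlforsRegular m δ a b)
    (hlu : IsLowerUpper l u) (hρ : IsUbiquityFunction ρ) (hψ : IsApproximatingFunction ψ)
    (hlim : Tendsto (fun n => ψ (u n) / ρ (u n)) atTop (𝓝 0)) (hγs : γ ≤ s) (hsδ : s ≤ δ)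
    (hM : 0 < M) (hfreq : ∃ᶠ n in atTop, ρ (u n) ^ (δ - γ) ≤ M * (ψ (u n) / 2) ^ (s - γ)) :
    HasSpreading m (blockSet R β ψ l u) δ s := by
  have ha := hm.lower_pos
  have hb := hm.upper_pos
  have hρ₀ := hρ.tendsto_upper hlu
  obtain ⟨c₁, hc₁, c₂, hc₂, hbounds⟩ := hub.2.exists_eventually_hasIntersectionBounds l
  obtain ⟨κ, hκ, t₀, ht₀, hZ⟩ :=
    hub.exists_eventually_separated_centres hm hρ.pos hlu.upper_pos hρ₀
  refine ⟨κ, hκ, M * (b * max 1 (c₂ * 3 ^ γ)) / (c₁ * a), by positivity, t₀, ht₀,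
    fun X t ht htt η hη => ?_⟩
  refine (hfreq.and_eventually ((hbounds.and (hZ X t ht htt)).and
    ((hρ₀.eventually_lt_const (lt_min hη one_pos)).and
      (hlim.eventually_lt_const one_pos)))).mono ?_
  rintro n ⟨hMn, ⟨hA, Z, hZR, hsep, hcard⟩, hρη, hψρ⟩
  have hψ₀ : 0 < ψ (u n) := hψ.pos _ (hlu.upper_pos n)
  replace hψρ : ψ (u n) < ρ (u n) := (div_lt_one (hρ.pos _ (hlu.upper_pos n))).1 hψρ
  obtain ⟨F, hF⟩ := exists_isPieceFamily_of_hasIntersectionBounds hm hA hc₁ hc₂ (half_pos hψ₀)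
    (by linarith) (hρη.le.trans (min_le_right _ _)) hγs hsδ hMn (E := blockSet R β ψ l u n)
    (fun A hA => (cthickening_subset_thickening' hψ₀ (half_lt_self hψ₀) A).trans
      (hψ.thickening_subset_blockSet (hlu.lower_pos n) le_rfl hA)) hZR hsep
  exact ⟨ρ (u n), hρη.trans_le (min_le_left _ _), Z, F, hF, hcard⟩

theorem measure_limsupSet_pos [Nonempty Ω] (hub : IsLocallyUbiquitous m R β ρ l u γ)
    (hm : IsAhlforsRegular m δ a b) (hlu : IsLowerUpper l u) (hρ : IsUbiquityFunction ρ)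
    (hψ : IsApproximatingFunction ψ) (hc₀ : 0 < c₀)
    (hfreq : ∃ᶠ n in atTop, ∃ t > 0, t ≤ ρ (u n) ∧ t ≤ ψ (u n) ∧
      c₀ * ρ (u n) ^ (δ - γ) ≤ t ^ (δ - γ)) :
    0 < m (limsupSet R β ψ) := by
  have ha := hm.lower_pos
  have hρ₀ := hρ.tendsto_upper hlu
  let x : Ω := Classical.arbitrary Ω
  obtain ⟨c₁, hc₁, c₂, -, hbounds⟩ := hub.2.exists_eventually_hasIntersectionBounds l
  obtain ⟨κ, hκ, t₀, ht₀, hZ⟩ :=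
    hub.exists_eventually_separated_centres hm hρ.pos hlu.upper_pos hρ₀
  suffices h : ∃ᶠ n in atTop, κ * t₀ ^ δ * (c₁ * a * c₀) ≤ m.real (blockSet R β ψ l u n) from
    (measure_frequently_pos (fun n => isOpen_blockSet.measurableSet) (by positivity) h).trans_le
      (measure_mono (frequently_blockSet_subset_limsupSet hlu.lower_tendsto))
  refine (hfreq.and_eventually ((hbounds.and (hZ {x} t₀ ht₀ le_rfl)).and
    (hρ₀.eventually_le_const one_pos))).mono ?_
  rintro n ⟨⟨t, ht, htp, htψ, hct⟩, ⟨hA, Z, hZR, hsep, hcard⟩, hp1⟩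
  have hp := hρ.pos _ (hlu.upper_pos n)
  have hpδ : ρ (u n) ^ δ = ρ (u n) ^ (δ - γ) * ρ (u n) ^ γ := by
    rw [← Real.rpow_add hp, sub_add_cancel]
  have hcardx : κ * t₀ ^ δ ≤ Z.card * ρ (u n) ^ δ :=
    (hcard x (Finset.mem_singleton_self x)).trans (by gcongr; exact nearby_subset)
  calc κ * t₀ ^ δ * (c₁ * a * c₀)
      ≤ Z.card * ρ (u n) ^ δ * (c₁ * a * c₀) := by gcongr
    _ = Z.card * (c₁ * a * (c₀ * ρ (u n) ^ (δ - γ) * ρ (u n) ^ γ)) := by rw [hpδ]; ring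
    _ ≤ Z.card * (c₁ * a * (t ^ (δ - γ) * ρ (u n) ^ γ)) := by gcongr
    _ ≤ m.real (⋃ A ∈ R '' indexBlock β l u n, thickening t A) :=
        card_mul_le_measureReal_biUnion_thickening hm hA hc₁ ht htp hp1 hZR hsep
    _ ≤ m.real (blockSet R β ψ l u n) := measureReal_mono
        (iUnion₂_subset fun A hA => hψ.thickening_subset_blockSet (hlu.lower_pos n) htψ hA)
        (measure_ne_top _ _)

theorem hausdorffMeasure_limsupSet_eq_top [CompleteSpace Ω] [Nonempty Ω]
    (hub : IsLocallyUbiquitous m R β ρ l u γ) (hm : IsAhlforsRegular m δ a b)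
    (hlu : IsLowerUpper l u) (hρ : IsUbiquityFunction ρ) (hψ : IsApproximatingFunction ψ)
    (hγδ : γ < δ) (hlim : Tendsto (fun n => ψ (u n) / ρ (u n)) atTop (𝓝 0)) (hτ : 0 ≤ τ)
    (hC : 0 < C) (hfreq : ∃ᶠ n in atTop, ρ (u n) ≤ C * ψ (u n) ^ τ) :
    Measure.hausdorffMeasure (γ + τ * (δ - γ)) (limsupSet R β ψ) = ⊤ := by
  have hρu : ∀ n, 0 < ρ (u n) := fun n => hρ.pos _ (hlu.upper_pos n)
  have hψu : ∀ n, 0 < ψ (u n) := fun n => hψ.pos _ (hlu.upper_pos n)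
  have hδγ : 0 < δ - γ := sub_pos.2 hγδ
  have hτδγ : 0 ≤ τ * (δ - γ) := by positivity
  have hτ1 : τ < 1 :=
    lt_one_of_frequently_le_mul_rpow hρu hψu (hρ.tendsto_upper hlu) hlim hC hfreq
  have hsδ : γ + τ * (δ - γ) < δ := by nlinarith
  have hE : HasSpreading m (blockSet R β ψ l u) δ (γ + τ * (δ - γ)) := by
    refine hub.hasSpreading hm hlu hρ hψ hlim (by linarith) hsδ.le
      (M := (C * 2 ^ τ) ^ (δ - γ)) (by positivity) (hfreq.mono fun n hn => ?_)
    have hψn := hψu n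
    calc ρ (u n) ^ (δ - γ) ≤ (C * ψ (u n) ^ τ) ^ (δ - γ) :=
          Real.rpow_le_rpow (hρu n).le hn hδγ.le
      _ = (C * 2 ^ τ * (ψ (u n) / 2) ^ τ) ^ (δ - γ) := by
          rw [Real.div_rpow hψn.le zero_le_two]
          field_simp
      _ = (C * 2 ^ τ) ^ (δ - γ) * (ψ (u n) / 2) ^ (γ + τ * (δ - γ) - γ) := by
          rw [Real.mul_rpow (by positivity) (by positivity), ← Real.rpow_mul (by positivity),
            add_sub_cancel_left]
  have := hm.compactSpace
  have := hm.neZero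
  have htop := hE.hausdorffMeasure_limsup_eq_top hm (by linarith [hub.2.1]) hsδ
  exact measure_mono_top (frequently_blockSet_subset_limsupSet hlu.lower_tendsto) htop

theorem ofReal_le_dimH_limsupSet [CompleteSpace Ω] [Nonempty Ω]
    (hub : IsLocallyUbiquitous m R β ρ l u γ) (hm : IsAhlforsRegular m δ a b)
    (hlu : IsLowerUpper l u) (hρ : IsUbiquityFunction ρ) (hψ : IsApproximatingFunction ψ)
    (hγδ : γ < δ) (hlim : Tendsto (fun n => ψ (u n) / ρ (u n)) atTop (𝓝 0)) :
    ENNReal.ofReal (γ + logExponent ρ ψ u * (δ - γ)) ≤ dimH (limsupSet R β ψ) := by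
  have hδγ : 0 < δ - γ := sub_pos.2 hγδ
  have hcont : Continuous fun τ : ℝ => ENNReal.ofReal (γ + τ * (δ - γ)) :=
    ENNReal.continuous_ofReal.comp (by fun_prop)
  refine le_of_tendsto (x := 𝓝[<] logExponent ρ ψ u)
    ((hcont.tendsto _).mono_left nhdsWithin_le_nhds) (eventually_mem_nhdsWithin.mono fun τ hτ => ?_)
  have hfreq := frequently_le_rpow_max_zero (fun n => hρ.pos _ (hlu.upper_pos n))
    (fun n => hψ.pos _ (hlu.upper_pos n)) (hρ.tendsto_upper hlu) hlim hτ
  have htop := hub.hausdorffMeasure_limsupSet_eq_top hm hlu hρ hψ hγδ hlim (le_max_right τ 0)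
    one_pos (by simpa only [one_mul] using hfreq)
  have hs : 0 ≤ γ + max τ 0 * (δ - γ) :=
    add_nonneg hub.2.1 (mul_nonneg (le_max_right _ _) hδγ.le)
  calc ENNReal.ofReal (γ + τ * (δ - γ)) ≤ ENNReal.ofReal (γ + max τ 0 * (δ - γ)) := by
        gcongr
        exact le_max_left _ _
    _ ≤ dimH (limsupSet R β ψ) :=
        le_dimH_of_hausdorffMeasure_eq_top (by rwa [Real.coe_toNNReal _ hs])

end IsLocallyUbiquitous

end LimsupSet

end Ubiquity

theorem corollary5_general {Ω : Type*} [MetricSpace Ω] [CompleteSpace Ω] [Nonempty Ω]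
    [MeasurableSpace Ω] [BorelSpace Ω] (m : Measure Ω) [IsFiniteMeasure m] {J : Type*}
    (R : J → Set Ω) (β : J → ℝ) (l u : ℕ → ℝ) (hlu : Ubiquity.IsLowerUpper l u)
    (ρ ψ : ℝ → ℝ) (hρ : Ubiquity.IsUbiquityFunction ρ) (hψ : Ubiquity.IsApproximatingFunction ψ)
    (δ γ : ℝ) (hM2 : Ubiquity.ConditionM2 m δ)
    (hub : Ubiquity.IsLocallyUbiquitous m R β ρ l u γ) :
    (δ ≠ γ → Tendsto (fun n => ψ (u n) / ρ (u n)) atTop (𝓝 0) →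
      ENNReal.ofReal (γ + Ubiquity.logExponent ρ ψ u * (δ - γ)) ≤
          dimH (Ubiquity.limsupSet R β ψ) ∧
        (liminf (fun n => ENNReal.ofReal
            (ρ (u n) / ψ (u n) ^ Ubiquity.logExponent ρ ψ u)) atTop < ⊤ →
          Measure.hausdorffMeasure (γ + Ubiquity.logExponent ρ ψ u * (δ - γ))
            (Ubiquity.limsupSet R β ψ) = ⊤)) ∧
    ((δ = γ ∨ 0 < limsup (fun n => ENNReal.ofReal (ψ (u n) / ρ (u n))) atTop) →
      0 < Measure.hausdorffMeasure δ (Ubiquity.limsupSet R β ψ) ∧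
        Measure.hausdorffMeasure δ (Ubiquity.limsupSet R β ψ) < ⊤ ∧
        dimH (Ubiquity.limsupSet R β ψ) = ENNReal.ofReal δ) := by
  obtain ⟨a, b, hm⟩ := hM2.exists_isAhlforsRegular
  have hρu : ∀ n, 0 < ρ (u n) := fun n => hρ.pos _ (hlu.upper_pos n)
  have hψu : ∀ n, 0 < ψ (u n) := fun n => hψ.pos _ (hlu.upper_pos n)
  refine ⟨fun hne hlim => ?_, fun hor => ?_⟩
  · have hγδ : γ < δ := hne.symm.lt_of_le <|
      (ENNReal.ofReal_le_ofReal_iff hm.exp_pos.le).1 (hub.2.2.1.trans hm.dimH_univ_le)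
    refine ⟨hub.ofReal_le_dimH_limsupSet hm hlu hρ hψ hγδ hlim, fun hfin => ?_⟩
    obtain ⟨C, hC, hfreq⟩ := Ubiquity.exists_frequently_le_mul_rpow hψu hfin
    exact hub.hausdorffMeasure_limsupSet_eq_top hm hlu hρ hψ hγδ hlim
      (Ubiquity.limsup_log_div_log_nonneg hρu hψu (hρ.tendsto_upper hlu) hlim) hC hfreq
  · obtain ⟨c, hc, hfreq⟩ := Ubiquity.exists_frequently_exists_mul_rpow_le hρu hψu
      (hor.imp_left sub_eq_zero.2)
    have hpos := hub.measure_limsupSet_pos hm hlu hρ hψ hc hfreq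
    exact ⟨hm.hausdorffMeasure_pos hpos,
      (measure_mono (subset_univ _)).trans_lt hm.hausdorffMeasure_univ_lt_top,
      hm.dimH_eq_of_measure_pos hpos⟩

open Ubiquity in
theorem corollary5 {Ω : Type*} [MetricSpace Ω] [CompactSpace Ω] [MeasurableSpace Ω] [BorelSpace Ω]
    (m : Measure Ω) [IsProbabilityMeasure m] [NullSingletonClass m]
    {J : Type*} [Countable J] [Infinite J]
    (R : J → Set Ω) (β : J → ℝ) (hβ : Ubiquity.IsWeight β)
    (l u : ℕ → ℝ) (hlu : Ubiquity.IsLowerUpper l u)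
    (ρ ψ : ℝ → ℝ) (hρ : Ubiquity.IsUbiquityFunction ρ) (hψ : Ubiquity.IsApproximatingFunction ψ)
    (δ γ : ℝ) (hM2 : Ubiquity.ConditionM2 m δ)
    (hub : Ubiquity.IsLocallyUbiquitous m R β ρ l u γ) :
    (δ ≠ γ → Tendsto (fun n => ψ (u n) / ρ (u n)) atTop (𝓝 0) →
      ENNReal.ofReal (γ + Ubiquity.logExponent ρ ψ u * (δ - γ)) ≤
          dimH (Ubiquity.limsupSet R β ψ) ∧
        (liminf (fun n => ENNReal.ofReal
            (ρ (u n) / ψ (u n) ^ Ubiquity.logExponent ρ ψ u)) atTop < ⊤ →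
          Measure.hausdorffMeasure (γ + Ubiquity.logExponent ρ ψ u * (δ - γ))
            (Ubiquity.limsupSet R β ψ) = ⊤)) ∧
    ((δ = γ ∨ 0 < limsup (fun n => ENNReal.ofReal (ψ (u n) / ρ (u n))) atTop) →
      0 < Measure.hausdorffMeasure δ (Ubiquity.limsupSet R β ψ) ∧
        Measure.hausdorffMeasure δ (Ubiquity.limsupSet R β ψ) < ⊤ ∧
        dimH (Ubiquity.limsupSet R β ψ) = ENNReal.ofReal δ) := by
  have := nonempty_of_isProbabilityMeasure m
  exact corollary5_general m R β l u hlu ρ ψ hρ hψ δ γ hM2 hub
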